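/- Let $\ell^2$ be the real Hilbert space of square summable sequences with its standard orthonormal basis $e_1,e_2,\dots$, and identify $\mathbb R^d$ with the linear span of $e_1,\dots,e_d$. Let $d_H$ be the Hausdorff distance on nonempty compact subsets of $\ell^2$. Two such sets $K_1,K_2$ are called equivalent, $K_1\sim K_2$, if there is a distance-preserving bijection $K_1\to K_2$; let $[K]$ be the equivalence class of $K$ and $\mathbb H$ the set of all equivalence classes. The Hausdorff distance up to isometry is $$d_\sim([K_1],[K_2])=\inf\{d_H(K_1',K_2') : K_1'\in[K_1],\ K_2'\in[K_2]\}.$$ The Wiener spiral is the compact set $\mathbb W=\{\widetilde w_t: 0\le t\le 1\}\subset\ell^2$, where $$\widetilde w_t=\frac{2\sqrt2}{\pi}\sum_{k=1}^\infty\frac{\sin(\pi(k-1/2)t)}{2k-1}\,e_k .$$ For every $d\in\mathbb N=\{1,2,\dots\}$ let $X^{(d)}_1,X^{(d)}_2,\dots$ be independent copies of a random vector $X^{(d)}=(X^{(d)}_{\cdot,1},\dots,X^{(d)}_{\cdot,d})$ in $\mathbb R^d$ (for different $d$ the probability spaces may be different), and put $S^{(d)}_0=0$, $S^{(d)}_k=X^{(d)}_1+\dots+X^{(d)}_k$.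 Assume: (a) $\mathbb E X^{(d)}=0$ and $\mathbb E\|X^{(d)}\|^2=1$ for every $d\in\mathbb N$; (b) $\mathbb E[X^{(d)}_{\cdot,j}X^{(d)}_{\cdot,k}]=0$ for all $d\in\mathbb N$ and $j\ne k$ in $\{1,\dots,d\}$; (c) $\lim_{A\to\infty}\sup_{d\in\mathbb N}\mathbb E\big[\|X^{(d)}\|^2\mathbf 1_{\{\|X^{(d)}\|^2>A\}}\big]=0$; (d) $\lim_{d\to\infty}\max_{1\le k\le d}\mathbb E (X^{(d)}_{\cdot,k})^2=0$. Let $n=n(d)$ be an arbitrary sequence of positive integers with $n(d)\to\infty$ as $d\to\infty$, and let $\mathbb M_d=\{S^{(d)}_k/\sqrt n: 0\le k\le n\}\subset\mathbb R^d\subset\ell^2$. **Theorem.** $[\operatorname{conv}\mathbb M_d]$ converges in probability to $[\overline{\operatorname{conv}}\,\mathbb W]$ in $(\mathbb H,d_\sim)$ as $d\to\infty$; that is, for every $\varepsilon>0$, $$\lim_{d\to\infty}\mathbb P\big[d_\sim([\operatorname{conv}\mathbb M_d],[\overline{\operatorname{conv}}\,\mathbb W])>\varepsilon\big]=0 .$$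 Moreover, the closed convex hull map $\mathrm{CCH}:\mathbb H\to\mathbb H$, $\mathrm{CCH}([K])=[\overline{\operatorname{conv}}\,K]$, is well defined and 1-Lipschitz: $d_\sim(\mathrm{CCH}(x),\mathrm{CCH}(y))\le d_\sim(x,y)$ for all $x,y\in\mathbb H$. -/

import Mathlib

open MeasureTheory ProbabilityTheory Filter Topology TopologicalSpace

noncomputable section

namespace WienerSpiral

/-- The real Hilbert space of square summable sequences. The basis vector usually called `e_{k+1}`
is `lp.single 2 k 1`, for `k = 0, 1, 2, …`. -/
abbrev L2Seq : Type := lp (fun _ : ℕ => ℝ) 2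

/-- The inclusion of `ℝ^d` in the space of square summable sequences, as the span of the first `d`
basis vectors. -/
def embed (d : ℕ) (x : EuclideanSpace ℝ (Fin d)) : L2Seq :=
  ∑ i : Fin d, lp.single 2 (i : ℕ) (x i)

/-! ### Compact sets up to isometry -/

/-- Two nonempty compact sets are equivalent if there is a distance-preserving bijection between
them (not necessarily defined outside of these sets). -/
def isometrySetoid : Setoid (NonemptyCompacts L2Seq) where
  r K L := Nonempty (K ≃ᵢ L)
  iseqv :=
    { refl := fun K => ⟨IsometryEquiv.refl K⟩
      symm := fun ⟨e⟩ => ⟨e.symm⟩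
      trans := fun ⟨e⟩ ⟨f⟩ => ⟨e.trans f⟩ }

/-- The set `ℍ` of isometry classes of nonempty compact subsets of `ℓ²`. -/
def Shape : Type := Quotient isometrySetoid

/-- The isometry class `[K]`. -/
def Shape.mk (K : NonemptyCompacts L2Seq) : Shape := Quotient.mk isometrySetoid K

/-- The Hausdorff distance up to isometry: the infimum of the Hausdorff distances of
representatives. The metric `dist` on `NonemptyCompacts L2Seq` is the Hausdorff distance. -/
def Shape.hdist (x y : Shape) : ℝ :=
  ⨅ p : {p : NonemptyCompacts L2Seq × NonemptyCompacts L2Seq //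
    Shape.mk p.1 = x ∧ Shape.mk p.2 = y}, dist p.1.1 p.1.2

/-- The closed convex hull of a nonempty compact set. -/
def cch (K : NonemptyCompacts L2Seq) : NonemptyCompacts L2Seq where
  carrier := closure (convexHull ℝ (K : Set L2Seq))
  isCompact' :=
    (totallyBounded_convexHull.2 K.isCompact.totallyBounded).closure.isCompact_of_isClosed
      isClosed_closure
  nonempty' := K.nonempty.convexHull.closure

/-! ### The Wiener spiral -/

/-- The coordinates of the Wiener spiral in `ℓ²`; the index `k` here is `k - 1` in the usual
formula `(2 √2 / π) sin (π (k - 1/2) t) / (2 k - 1)` with `k ≥ 1`. -/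
def spiralCoord (t : ℝ) (k : ℕ) : ℝ :=
  2 * √2 / Real.pi * (Real.sin (Real.pi * (k + 1 / 2) * t) / (2 * k + 1))

theorem summable_bound : Summable fun k : ℕ => (2 * √2 / Real.pi / (2 * (k : ℝ) + 1)) ^ 2 := by
  have h := ((summable_nat_add_iff 1).2
    (Real.summable_one_div_nat_pow.2 (by norm_num : 1 < 2))).mul_left ((2 * √2 / Real.pi) ^ 2)
  refine Summable.of_nonneg_of_le (fun k => sq_nonneg _) (fun k => ?_) h
  rw [div_pow, div_eq_mul_one_div]
  have hk : (0 : ℝ) ≤ k := k.cast_nonneg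
  push_cast
  gcongr
  linarith

theorem abs_spiralCoord_le (t : ℝ) (k : ℕ) :
    |spiralCoord t k| ≤ 2 * √2 / Real.pi / (2 * (k : ℝ) + 1) := by
  have hk : (0 : ℝ) < 2 * k + 1 := by positivity
  have hc : (0 : ℝ) ≤ 2 * √2 / Real.pi := by positivity
  rw [spiralCoord, abs_mul, abs_of_nonneg hc, abs_div, abs_of_pos hk, ← mul_one_div (_ / Real.pi)]
  gcongr
  exact Real.abs_sin_le_one _

theorem memlp_spiralCoord (t : ℝ) : Memℓp (E := fun _ : ℕ => ℝ) (spiralCoord t) 2 := by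
  refine memℓp_gen ?_
  refine Summable.of_nonneg_of_le (fun k => by positivity) (fun k => ?_) summable_bound
  have h2 : (2 : ENNReal).toReal = ((2 : ℕ) : ℝ) := by simp
  rw [h2, Real.rpow_natCast, Real.norm_eq_abs]
  have := abs_spiralCoord_le t k
  gcongr

/-- The point of the Wiener spiral in `ℓ²` with parameter `t`. -/
def spiralPoint (t : ℝ) : L2Seq := ⟨spiralCoord t, memlp_spiralCoord t⟩

theorem continuous_spiralPoint : Continuous spiralPoint := by
  have h2 : (2 : ENNReal).toReal = ((2 : ℕ) : ℝ) := by simp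
  rw [continuous_iff_continuousAt]
  intro s
  rw [ContinuousAt, tendsto_iff_norm_sub_tendsto_zero]
  have hsq : ∀ t, ‖spiralPoint t - spiralPoint s‖ ^ 2 =
      ∑' k : ℕ, (spiralCoord t k - spiralCoord s k) ^ 2 := by
    intro t
    have h := lp.norm_rpow_eq_tsum (p := 2) (by simp) (spiralPoint t - spiralPoint s)
    simp only [h2, Real.rpow_natCast] at h
    rw [h]
    refine tsum_congr fun k => ?_
    rw [Real.norm_eq_abs, sq_abs]
    rfl
  have hcont : Continuous fun t => ∑' k : ℕ, (spiralCoord t k - spiralCoord s k) ^ 2 := by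
    refine continuous_tsum (fun k => ?_) (summable_bound.mul_left 4) (fun k t => ?_)
    · unfold spiralCoord
      fun_prop
    · rw [Real.norm_eq_abs, abs_pow]
      have h1 := abs_spiralCoord_le t k
      have h3 := abs_spiralCoord_le s k
      have h4 : |spiralCoord t k - spiralCoord s k| ≤
          2 * (2 * √2 / Real.pi / (2 * (k : ℝ) + 1)) :=
        (abs_sub _ _).trans (by linarith)
      calc |spiralCoord t k - spiralCoord s k| ^ 2
          ≤ (2 * (2 * √2 / Real.pi / (2 * (k : ℝ) + 1))) ^ 2 := by gcongr
        _ = _ := by ring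
  have h0 := (hcont.tendsto s).sqrt
  simp only [sub_self, ne_eq, OfNat.ofNat_ne_zero, not_false_eq_true, zero_pow, tsum_zero,
    Real.sqrt_zero] at h0
  refine h0.congr fun t => ?_
  rw [← hsq, Real.sqrt_sq (norm_nonneg _)]

/-- The Wiener spiral as a compact subset of `ℓ²`. -/
def spiral : NonemptyCompacts L2Seq where
  carrier := spiralPoint '' Set.Icc 0 1
  isCompact' := isCompact_Icc.image continuous_spiralPoint
  nonempty' := (Set.nonempty_Icc.2 zero_le_one).image _

/-! ### The rescaled random walk -/

/-- The points `0, S_1 / √n, …, S_n / √n` in `ℓ²`, where `S_k` is the sum of the first `k` of the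
increments `x 0, x 1, …` in `ℝ^d`. -/
def walkPoints {d : ℕ} (n : ℕ) (x : ℕ → EuclideanSpace ℝ (Fin d)) : Set L2Seq :=
  (fun k : ℕ => embed d ((√(n : ℝ))⁻¹ • ∑ i ∈ Finset.range k, x i)) '' Set.Iic n

/-- The convex hull of the rescaled walk (it is compact, being the hull of a finite set). -/
def walkHull {d : ℕ} (n : ℕ) (x : ℕ → EuclideanSpace ℝ (Fin d)) : NonemptyCompacts L2Seq where
  carrier := convexHull ℝ (walkPoints n x)
  isCompact' := Set.Finite.isCompact_convexHull (𝕜 := ℝ) ((Set.finite_Iic n).image _)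
  nonempty' := (Set.nonempty_Iic.image _).convexHull

end WienerSpiral

end

/-!
The proof compares Gram matrices. The Wiener spiral satisfies `⟪w_s, w_t⟫ = min s t`, and the
points `W_t` of the walk at times `⌊t n⌋` satisfy `⟪W_s, W_t⟫ → min s t` in probability. Finite
configurations with nearby Gram matrices can be moved by isometries of `ℓ²` to nearby positions: the
columns of the square root of the Gram matrix form a copy of the configuration, and the square root
is continuous. Applied to fine nets of the walk and of the spiral this gives `d_∼([𝕄_d], [𝕎]) → 0`
in probability, and the hulls follow because the closed convex hull map is `1`-Lipschitz.

For the convergence of the inner products it is enough, by polarization, that `𝔼 |‖S‖² - m| = o(n)`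
for sums `S` of `m ≤ n` increments. The mixed terms `⟪X_i, X_j⟫` of `‖S‖²` are pairwise
uncorrelated with variances at most the largest coordinate variance, and the sum of the `‖X_i‖²`
obeys the law of large numbers by truncation. The same bound controls the walk between the points of
the net: `‖S_k‖²` is a submartingale, so Doob's inequality
`c ℙ(A) ≤ 𝔼[‖S_m‖²; A] ≤ m ℙ(A) + 𝔼 |‖S_m‖² - m|` for `A = {max_{k ≤ m} ‖S_k‖² ≥ c}` makes `A`
unlikely as soon as `c` exceeds `m` by a fixed multiple of `n`.
-/

noncomputable section

namespace WienerSpiral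

/-! ### Closed convex hulls and isometries -/

section ClosedConvexHull

variable {E F : Type*} [NormedAddCommGroup E] [NormedAddCommGroup F]

theorem apply_eq_of_mem_closure_convexHull [NormedSpace ℝ E] (l : E →L[ℝ] ℝ) {s : Set E} {r : ℝ}
    (hl : ∀ a ∈ s, l a = r) {a : E} (ha : a ∈ closure (convexHull ℝ s)) : l a = r :=
  closure_minimal (convexHull_min hl (convex_hyperplane l.isLinear r))
    (isClosed_eq l.continuous continuous_const) ha

theorem image_closure_convexHull_of_isCompact [NormedSpace ℝ E] [CompleteSpace E]
    [NormedSpace ℝ F] (l : E →L[ℝ] F) {s : Set E} (hs : IsCompact s) :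
    l '' closure (convexHull ℝ s) = closure (convexHull ℝ (l '' s)) := by
  have hc : IsCompact (closure (convexHull ℝ s)) :=
    (totallyBounded_convexHull.2 hs.totallyBounded).closure.isCompact_of_isClosed isClosed_closure
  rw [image_closure_of_isCompact hc l.continuous.continuousOn]
  exact congrArg closure (l.toLinearMap.image_convexHull s)

theorem hausdorffEDist_convexHull_le [NormedSpace ℝ E] (s t : Set E) :
    Metric.hausdorffEDist (convexHull ℝ s) (convexHull ℝ t) ≤ Metric.hausdorffEDist s t := by
  rcases eq_or_ne (Metric.hausdorffEDist s t) ⊤ with htop | htop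
  · exact htop ▸ le_top
  have infEDist_le : ∀ {u v : Set E}, Metric.hausdorffEDist u v = Metric.hausdorffEDist s t →
      ∀ x ∈ convexHull ℝ u,
        Metric.infEDist x (convexHull ℝ v) ≤ Metric.hausdorffEDist s t := by
    intro u v huv x hx
    have hu : u ⊆ Metric.cthickening (Metric.hausdorffEDist s t).toReal (convexHull ℝ v) := by
      intro y hy
      rw [Metric.mem_cthickening_iff, ENNReal.ofReal_toReal htop, ← huv]
      exact (Metric.infEDist_anti (subset_convexHull ℝ v)).trans
        (Metric.infEDist_le_hausdorffEDist_of_mem hy)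
    rw [← ENNReal.ofReal_toReal htop]
    exact convexHull_min hu ((convex_convexHull ℝ v).cthickening _) hx
  exact Metric.hausdorffEDist_le_of_infEDist (infEDist_le rfl)
    (infEDist_le Metric.hausdorffEDist_comm)

variable [InnerProductSpace ℝ E] [InnerProductSpace ℝ F]

theorem inner_sub_eq_inner_sub_of_mem_closure_convexHull {G : Set (E × F)} {o c : E × F}
    (hc : ∀ a ∈ G, inner ℝ (a.1 - o.1) (c.1 - o.1) = inner ℝ (a.2 - o.2) (c.2 - o.2))
    {a : E × F} (ha : a ∈ closure (convexHull ℝ G)) :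
    inner ℝ (a.1 - o.1) (c.1 - o.1) = inner ℝ (a.2 - o.2) (c.2 - o.2) := by
  let l : E × F →L[ℝ] ℝ := innerSL ℝ (c.1 - o.1) ∘L .fst ℝ E F - innerSL ℝ (c.2 - o.2) ∘L .snd ℝ E F
  have hl : ∀ a, l a - l o =
      inner ℝ (a.1 - o.1) (c.1 - o.1) - inner ℝ (a.2 - o.2) (c.2 - o.2) := by
    intro a
    rw [real_inner_comm, real_inner_comm (c.2 - o.2), ← map_sub]
    rfl
  have hG : ∀ a ∈ G, l a = l o := fun a ha => by rw [← sub_eq_zero, hl, hc a ha, sub_self]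
  rw [← sub_eq_zero, ← hl, apply_eq_of_mem_closure_convexHull l hG ha, sub_self]

theorem dist_fst_eq_dist_snd_of_mem_closure_convexHull {G : Set (E × F)}
    (hG : ∀ a ∈ G, ∀ b ∈ G, dist a.1 b.1 = dist a.2 b.2) {a b : E × F}
    (ha : a ∈ closure (convexHull ℝ G)) (hb : b ∈ closure (convexHull ℝ G)) :
    dist a.1 b.1 = dist a.2 b.2 := by
  obtain ⟨o, ho⟩ : G.Nonempty := convexHull_nonempty_iff.1 (closure_nonempty_iff.1 ⟨a, ha⟩)
  have inner_eq : ∀ a ∈ closure (convexHull ℝ G), ∀ b ∈ closure (convexHull ℝ G),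
      inner ℝ (a.1 - o.1) (b.1 - o.1) = inner ℝ (a.2 - o.2) (b.2 - o.2) := by
    intro a ha b hb
    refine inner_sub_eq_inner_sub_of_mem_closure_convexHull (fun a' ha' => ?_) ha
    rw [real_inner_comm, real_inner_comm (b.2 - o.2)]
    refine inner_sub_eq_inner_sub_of_mem_closure_convexHull (fun b' hb' => ?_) hb
    simp only [real_inner_eq_norm_mul_self_add_norm_mul_self_sub_norm_sub_mul_self_div_two,
      sub_sub_sub_cancel_right, ← dist_eq_norm, hG _ ha' _ ho, hG _ hb' _ ho, hG _ hb' _ ha']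
  rw [dist_eq_norm, dist_eq_norm, ← sub_sub_sub_cancel_right a.1 _ o.1,
    ← sub_sub_sub_cancel_right a.2 b.2 o.2, ← sq_eq_sq₀ (norm_nonneg _) (norm_nonneg _),
    norm_sub_sq_real (a.1 - o.1), norm_sub_sq_real (a.2 - o.2)]
  simp only [← real_inner_self_eq_norm_sq, inner_eq _ ha _ ha, inner_eq _ ha _ hb,
    inner_eq _ hb _ hb]

end ClosedConvexHull

theorem nonempty_isometryEquiv_image_fst_image_snd {α β : Type*} [MetricSpace α] [MetricSpace β]
    {R : Set (α × β)} (hR : ∀ a ∈ R, ∀ b ∈ R, dist a.1 b.1 = dist a.2 b.2) :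
    Nonempty (Prod.fst '' R ≃ᵢ Prod.snd '' R) := by
  have hfst : Set.InjOn Prod.fst R := fun a ha b hb h =>
    Prod.ext h (dist_eq_zero.1 (by rw [← hR a ha b hb, h, dist_self]))
  have hsnd : Set.InjOn Prod.snd R := fun a ha b hb h =>
    Prod.ext (dist_eq_zero.1 (by rw [hR a ha b hb, h, dist_self])) h
  refine ⟨(Equiv.Set.imageOfInjOn _ R hfst).symm.trans (Equiv.Set.imageOfInjOn _ R hsnd),
    Isometry.of_dist_eq fun x y => ?_⟩
  obtain ⟨a, rfl⟩ := (Equiv.Set.imageOfInjOn _ R hfst).surjective x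
  obtain ⟨b, rfl⟩ := (Equiv.Set.imageOfInjOn _ R hfst).surjective y
  simp only [Equiv.toFun_as_coe, Equiv.trans_apply, Equiv.symm_apply_apply]
  exact (hR _ a.2 _ b.2).symm

theorem nonempty_isometryEquiv_cch {K L : NonemptyCompacts L2Seq} (e : K ≃ᵢ L) :
    Nonempty (cch K ≃ᵢ cch L) := by
  let G : Set (L2Seq × L2Seq) := Set.range fun x : K => ((x : L2Seq), (e x : L2Seq))
  have hG : IsCompact G := by
    have : CompactSpace K := isCompact_iff_compactSpace.1 K.isCompact
    have := e.continuous
    exact isCompact_range (by fun_prop)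
  have hdist : ∀ a ∈ G, ∀ b ∈ G, dist a.1 b.1 = dist a.2 b.2 := by
    rintro _ ⟨x, rfl⟩ _ ⟨y, rfl⟩
    exact (e.isometry.dist_eq x y).symm
  have hfst : Prod.fst '' G = (K : Set L2Seq) := by
    rw [← Set.range_comp]
    exact Subtype.range_coe
  have hsnd : Prod.snd '' G = (L : Set L2Seq) := by
    rw [← Set.range_comp]
    exact (e.surjective.range_comp ((↑) : L → L2Seq)).trans Subtype.range_coe
  have hK : Prod.fst '' closure (convexHull ℝ G) = (cch K : Set L2Seq) :=
    (image_closure_convexHull_of_isCompact (.fst ℝ L2Seq L2Seq) hG).trans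
      (congrArg (fun s => closure (convexHull ℝ s)) hfst)
  have hL : Prod.snd '' closure (convexHull ℝ G) = (cch L : Set L2Seq) :=
    (image_closure_convexHull_of_isCompact (.snd ℝ L2Seq L2Seq) hG).trans
      (congrArg (fun s => closure (convexHull ℝ s)) hsnd)
  obtain ⟨f⟩ := nonempty_isometryEquiv_image_fst_image_snd fun a ha b hb =>
    dist_fst_eq_dist_snd_of_mem_closure_convexHull hdist ha hb
  rw [hK, hL] at f
  exact ⟨f⟩

theorem dist_cch_le (K L : NonemptyCompacts L2Seq) : dist (cch K) (cch L) ≤ dist K L := by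
  rw [Metric.NonemptyCompacts.dist_eq, Metric.NonemptyCompacts.dist_eq]
  refine Metric.hausdorffDist_closure.trans_le (ENNReal.toReal_mono ?_
    (hausdorffEDist_convexHull_le _ _))
  exact Metric.hausdorffEDist_ne_top_of_nonempty_of_bounded K.nonempty L.nonempty
    K.isCompact.isBounded L.isCompact.isBounded

theorem Shape.hdist_mk_le (K L : NonemptyCompacts L2Seq) :
    Shape.hdist (Shape.mk K) (Shape.mk L) ≤ dist K L :=
  ciInf_le (f := fun p : {p : NonemptyCompacts L2Seq × NonemptyCompacts L2Seq //
    Shape.mk p.1 = Shape.mk K ∧ Shape.mk p.2 = Shape.mk L} => dist p.1.1 p.1.2)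
    ⟨0, by rintro _ ⟨p, rfl⟩; exact dist_nonneg⟩ ⟨(K, L), rfl, rfl⟩

/-- The closed convex hull map on isometry classes. -/
def Shape.cch : Shape → Shape :=
  Quotient.lift (fun K => Shape.mk (WienerSpiral.cch K)) fun _ _ ⟨e⟩ =>
    Quotient.sound (nonempty_isometryEquiv_cch e)

theorem Shape.cch_mk (K : NonemptyCompacts L2Seq) :
    Shape.cch (Shape.mk K) = Shape.mk (WienerSpiral.cch K) := rfl

theorem Shape.hdist_cch_le (x y : Shape) :
    Shape.hdist (Shape.cch x) (Shape.cch y) ≤ Shape.hdist x y := by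
  obtain ⟨K₀, hK₀⟩ := Quotient.exists_rep x
  obtain ⟨L₀, hL₀⟩ := Quotient.exists_rep y
  have : Nonempty {p : NonemptyCompacts L2Seq × NonemptyCompacts L2Seq //
      Shape.mk p.1 = x ∧ Shape.mk p.2 = y} := ⟨⟨(K₀, L₀), hK₀, hL₀⟩⟩
  refine le_ciInf ?_
  rintro ⟨⟨K, L⟩, rfl, rfl⟩
  exact (Shape.hdist_mk_le _ _).trans (dist_cch_le K L)

theorem Shape.mk_map (K : NonemptyCompacts L2Seq) {f : L2Seq → L2Seq} (hf : Isometry f) :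
    Shape.mk (K.map f hf.continuous) = Shape.mk K := by
  refine (Quotient.sound ⟨?_⟩ : Shape.mk K = Shape.mk (K.map f hf.continuous)).symm
  exact IsometryEquiv.mk (Equiv.Set.image f (K : Set L2Seq) hf.injective)
    (Isometry.of_dist_eq fun x y => hf.dist_eq _ _)

/-! ### The covariance of the Wiener spiral -/

theorem hasSum_cos_div_sq {x : ℝ} (hx : x ∈ Set.Icc (0 : ℝ) 1) :
    HasSum (fun n : ℕ => 1 / (n : ℝ) ^ 2 * Real.cos (2 * Real.pi * n * x))
      (Real.pi ^ 2 * (x ^ 2 - x + 1 / 6)) := by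
  convert! hasSum_one_div_nat_pow_mul_cos one_ne_zero hx using 1
  have h : Polynomial.bernoulli 2 =
      Polynomial.X ^ 2 - Polynomial.X + Polynomial.C (1 / 6 : ℚ) := by
    simp only [Polynomial.bernoulli, Finset.sum_range_succ, Finset.range_one,
      Finset.sum_singleton, ← Polynomial.C_mul_X_pow_eq_monomial]
    rw [bernoulli_zero, bernoulli_one, bernoulli_eq_bernoulli'_of_ne_one (by decide : 2 ≠ 1),
      bernoulli'_two]
    norm_num [Nat.choose]
    ring
  rw [mul_one, h]
  simp only [Nat.factorial, Polynomial.map_add, Polynomial.map_sub, Polynomial.map_pow,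
    Polynomial.map_X, Polynomial.map_C, Polynomial.eval_add, Polynomial.eval_sub,
    Polynomial.eval_pow, Polynomial.eval_X, Polynomial.eval_C]
  rw [eq_ratCast]
  push_cast
  ring

theorem hasSum_cos_odd_div_sq {x : ℝ} (hx : x ∈ Set.Icc (0 : ℝ) (1 / 2)) :
    HasSum (fun n : ℕ => 1 / (2 * (n : ℝ) + 1) ^ 2 * Real.cos (2 * Real.pi * (2 * n + 1) * x))
      (Real.pi ^ 2 / 8 - Real.pi ^ 2 * x / 2) := by
  obtain ⟨h0, h1⟩ := hx
  have hall := hasSum_cos_div_sq (x := x) ⟨h0, by linarith⟩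
  have heven := (hasSum_cos_div_sq (x := 2 * x) ⟨by linarith, by linarith⟩).div_const 4
  set f : ℕ → ℝ := fun n => 1 / (n : ℝ) ^ 2 * Real.cos (2 * Real.pi * n * x) with hf
  have he : HasSum (fun k => f (2 * k)) (Real.pi ^ 2 * ((2 * x) ^ 2 - 2 * x + 1 / 6) / 4) := by
    convert! heven using 1
    funext k
    simp only [hf]
    push_cast
    rw [show 2 * Real.pi * (2 * (k : ℝ)) * x = 2 * Real.pi * k * (2 * x) by ring]
    rcases eq_or_ne (k : ℝ) 0 with hk | hk
    · simp [hk]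
    · field_simp
      ring_nf
  have ho : Summable fun k => f (2 * k + 1) :=
    hall.summable.comp_injective fun a b (h : 2 * a + 1 = 2 * b + 1) => by omega
  have hsum := (he.even_add_odd ho.hasSum).unique hall
  have hval : ∑' k, f (2 * k + 1) = Real.pi ^ 2 / 8 - Real.pi ^ 2 * x / 2 := by
    linear_combination hsum
  have := ho.hasSum
  rw [hval] at this
  convert! this using 1
  funext k
  simp [hf]

theorem spiralCoord_mul_spiralCoord (s t : ℝ) (k : ℕ) :
    spiralCoord s k * spiralCoord t k = 4 / Real.pi ^ 2 *
      (1 / (2 * (k : ℝ) + 1) ^ 2 * Real.cos (2 * Real.pi * (2 * k + 1) * ((t - s) / 4)) -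
        1 / (2 * (k : ℝ) + 1) ^ 2 * Real.cos (2 * Real.pi * (2 * k + 1) * ((t + s) / 4))) := by
  have hcos (a b : ℝ) : Real.cos (b - a) - Real.cos (b + a) = 2 * (Real.sin a * Real.sin b) := by
    rw [Real.cos_sub, Real.cos_add]
    ring
  have hsub : 2 * Real.pi * (2 * (k : ℝ) + 1) * ((t - s) / 4) =
      Real.pi * (k + 1 / 2) * t - Real.pi * (k + 1 / 2) * s := by ring
  have hadd : 2 * Real.pi * (2 * (k : ℝ) + 1) * ((t + s) / 4) =
      Real.pi * (k + 1 / 2) * t + Real.pi * (k + 1 / 2) * s := by ring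
  rw [← mul_sub, hsub, hadd, hcos, spiralCoord, spiralCoord]
  generalize Real.sin (Real.pi * (k + 1 / 2) * s) = x, Real.sin (Real.pi * (k + 1 / 2) * t) = y
  have hsqrt : √2 ^ 2 = 2 := Real.sq_sqrt zero_le_two
  field_simp
  linear_combination 2 * x * y * hsqrt

theorem inner_spiralPoint {s t : ℝ} (hs : s ∈ Set.Icc (0 : ℝ) 1) (ht : t ∈ Set.Icc (0 : ℝ) 1) :
    inner ℝ (spiralPoint s) (spiralPoint t) = min s t := by
  wlog hst : s ≤ t generalizing s t
  · rw [real_inner_comm, this ht hs (le_of_not_ge hst), min_comm]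
  obtain ⟨hs0, -⟩ := hs
  obtain ⟨-, ht1⟩ := ht
  have hsub := hasSum_cos_odd_div_sq (x := (t - s) / 4) ⟨by linarith, by linarith⟩
  have hadd := hasSum_cos_odd_div_sq (x := (t + s) / 4) ⟨by linarith, by linarith⟩
  have hcoord := ((hsub.sub hadd).mul_left (4 / Real.pi ^ 2)).congr_fun
    (spiralCoord_mul_spiralCoord s t)
  have hinner : HasSum (fun k => spiralCoord s k * spiralCoord t k)
      (inner ℝ (spiralPoint s) (spiralPoint t)) :=
    (lp.hasSum_inner (𝕜 := ℝ) (spiralPoint s) (spiralPoint t)).congr_fun fun k =>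
      mul_comm (spiralCoord s k) (spiralCoord t k)
  rw [hinner.unique hcoord, min_eq_left hst]
  field_simp
  ring

theorem norm_spiralPoint_sub_sq {s t : ℝ} (hs : s ∈ Set.Icc (0 : ℝ) 1)
    (ht : t ∈ Set.Icc (0 : ℝ) 1) : ‖spiralPoint s - spiralPoint t‖ ^ 2 = |s - t| := by
  rw [norm_sub_sq_real, ← real_inner_self_eq_norm_sq, ← real_inner_self_eq_norm_sq,
    inner_spiralPoint hs hs, inner_spiralPoint hs ht, inner_spiralPoint ht ht, min_self, min_self,
    ← max_sub_min_eq_abs']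
  linarith [min_add_max s t]

/-! ### Isometric embeddings and Gram matrices -/

section GramMatrix

variable {E F : Type*} [NormedAddCommGroup E] [InnerProductSpace ℝ E]
  [NormedAddCommGroup F] [InnerProductSpace ℝ F]

theorem orthonormal_single : Orthonormal ℝ fun k : ℕ => (lp.single 2 k (1 : ℝ) : L2Seq) := by
  have h := (HilbertBasis.ofRepr (LinearIsometryEquiv.refl ℝ L2Seq)).orthonormal
  convert! h using 1
  funext k
  rw [← HilbertBasis.repr_symm_single]
  rfl

instance : SeparableSpace L2Seq := by
  let b : HilbertBasis ℕ ℝ L2Seq := .ofRepr (LinearIsometryEquiv.refl ℝ L2Seq)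
  have h := (Set.countable_range b).isSeparable.span (R := ℝ) |>.closure
  rwa [← Submodule.topologicalClosure_coe, b.dense_span, Submodule.top_coe, isSeparable_univ_iff]
    at h

theorem countable_of_orthonormal [SeparableSpace E] {ι : Type*} {v : ι → E}
    (hv : Orthonormal ℝ v) : Countable ι := by
  have hdisj : Pairwise fun i j => Disjoint (Metric.ball (v i) 2⁻¹) (Metric.ball (v j) 2⁻¹) := by
    intro i j hij
    refine Metric.ball_disjoint_ball ?_
    have hsq : dist (v i) (v j) ^ 2 = 2 := by
      rw [dist_eq_norm, norm_sub_sq_real, hv.1, hv.1, hv.2 hij]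
      norm_num
    nlinarith [dist_nonneg (x := v i) (y := v j)]
  exact hdisj.countable_of_isOpen_disjoint (fun i => Metric.isOpen_ball)
    fun i => Metric.nonempty_ball.2 (by norm_num)

theorem nonempty_linearIsometry_l2Seq (E : Type*) [NormedAddCommGroup E] [InnerProductSpace ℝ E]
    [CompleteSpace E] [SeparableSpace E] : Nonempty (E →ₗᵢ[ℝ] L2Seq) := by
  obtain ⟨s, b, -⟩ := exists_hilbertBasis ℝ E
  have : Countable s := countable_of_orthonormal b.orthonormal
  obtain ⟨f, hf⟩ := exists_injective_nat s
  exact ⟨(orthonormal_single.comp f hf).orthogonalFamily.linearIsometry.comp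
    b.repr.toLinearIsometry⟩

theorem exists_linearIsometry_range {M : Type*} [AddCommGroup M] [Module ℝ M] {f : M →ₗ[ℝ] E}
    {g : M →ₗ[ℝ] F} (h : ∀ x, ‖f x‖ = ‖g x‖) :
    ∃ V : f.range →ₗᵢ[ℝ] F, ∀ x, V (f.rangeRestrict x) = g x := by
  obtain ⟨r, hr⟩ := LinearMap.exists_rightInverse_of_surjective _ f.range_rangeRestrict
  have hfr : ∀ y, f (r y) = y := fun y => congrArg Subtype.val (LinearMap.congr_fun hr y)
  refine ⟨⟨g ∘ₗ r, fun y => ?_⟩, fun x => sub_eq_zero.1 (norm_eq_zero.1 ?_)⟩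
  · rw [LinearMap.comp_apply, ← h, hfr, Submodule.coe_norm]
  · change ‖g (r (f.rangeRestrict x)) - g x‖ = 0
    rw [← map_sub, ← h, map_sub, hfr, LinearMap.codRestrict_apply, sub_self, norm_zero]

theorem exists_linearIsometry_extending (K : Submodule ℝ E) [K.HasOrthogonalProjection]
    (V : K →ₗᵢ[ℝ] F) :
    ∃ Φ : E →ₗᵢ[ℝ] WithLp 2 (F × E), ∀ x : K, Φ x = WithLp.toLp 2 (V x, 0) := by
  let D : WithLp 2 (K × Kᗮ) →ₗ[ℝ] WithLp 2 (F × E) :=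
    (WithLp.linearEquiv 2 ℝ (F × E)).symm.toLinearMap ∘ₗ
      V.toLinearMap.prodMap Kᗮ.subtype ∘ₗ (WithLp.linearEquiv 2 ℝ (K × Kᗮ)).toLinearMap
  have hD : ∀ x, ‖D x‖ = ‖x‖ := by
    intro x
    rw [← sq_eq_sq₀ (norm_nonneg _) (norm_nonneg _), WithLp.prod_norm_sq_eq_of_L2,
      WithLp.prod_norm_sq_eq_of_L2]
    simp [D]
  refine ⟨LinearIsometry.comp ⟨D, hD⟩ K.orthogonalDecomposition.toLinearIsometry, fun x => ?_⟩
  simp [D]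

theorem exists_linearIsometry_of_inner_eq {ι : Type*} [Finite ι] {y : ι → E} {b : ι → F}
    (h : ∀ i j, inner ℝ (y i) (y j) = inner ℝ (b i) (b j)) :
    ∃ Φ : E →ₗᵢ[ℝ] WithLp 2 (F × E), ∀ i, Φ (y i) = WithLp.toLp 2 (b i, 0) := by
  classical
  have := Fintype.ofFinite ι
  have norm_eq : ∀ c, ‖Fintype.linearCombination ℝ y c‖ = ‖Fintype.linearCombination ℝ b c‖ := by
    intro c
    simp only [← sq_eq_sq₀ (norm_nonneg _) (norm_nonneg _), ← real_inner_self_eq_norm_sq,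
      Fintype.linearCombination_apply, sum_inner, inner_sum, inner_smul_left, inner_smul_right, h]
  obtain ⟨V, hV⟩ := exists_linearIsometry_range norm_eq
  obtain ⟨Φ, hΦ⟩ := exists_linearIsometry_extending _ V
  refine ⟨Φ, fun i => ?_⟩
  simpa [hV, Fintype.linearCombination_apply_single] using
    hΦ ((Fintype.linearCombination ℝ y).rangeRestrict (Pi.single i 1))

open scoped MatrixOrder Matrix.Norms.L2Operator

variable {ι : Type*} [Fintype ι] [DecidableEq ι]

/-- A copy in `ℝ^ι` of the configuration `y`, with the same Gram matrix: the columns of the square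
root of that matrix. As the square root is continuous, the copy depends continuously on the inner
products `⟪y i, y j⟫`. -/
def gramRoot (y : ι → E) (i : ι) : EuclideanSpace ℝ ι :=
  WithLp.toLp 2 fun k => CFC.sqrt (Matrix.gram ℝ y) k i

theorem inner_gramRoot (y : ι → E) (i j : ι) :
    inner ℝ (gramRoot y i) (gramRoot y j) = inner ℝ (y i) (y j) := by
  have hpos : 0 ≤ Matrix.gram ℝ y := (Matrix.posSemidef_gram ℝ y).nonneg
  have hsqrt := congrArg (· i j) (CFC.sqrt_mul_sqrt_self _ hpos)
  have hsymm : ∀ k, CFC.sqrt (Matrix.gram ℝ y) k i = CFC.sqrt (Matrix.gram ℝ y) i k := fun k =>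
    (Matrix.nonneg_iff_posSemidef.1 (CFC.sqrt_nonneg _)).isHermitian.apply i k
  simp only [Matrix.mul_apply, Matrix.gram_apply] at hsqrt
  simp only [gramRoot, PiLp.inner_apply, RCLike.inner_apply, conj_trivial, hsymm, ← hsqrt, mul_comm]

theorem tendsto_gramRoot {α : Type*} {l : Filter α} {y : α → ι → E} {w : ι → F}
    (h : ∀ i j, Tendsto (fun a => inner ℝ (y a i) (y a j)) l (𝓝 (inner ℝ (w i) (w j)))) (i : ι) :
    Tendsto (fun a => gramRoot (y a) i) l (𝓝 (gramRoot w i)) := by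
  have hgram : Tendsto (fun a => Matrix.gram ℝ (y a)) l
      (𝓝[{A : Matrix ι ι ℝ | 0 ≤ A}] (Matrix.gram ℝ w)) :=
    tendsto_nhdsWithin_iff.2 ⟨tendsto_pi_nhds.2 fun i => tendsto_pi_nhds.2 fun j => h i j,
      .of_forall fun a => (Matrix.posSemidef_gram ℝ (y a)).nonneg⟩
  have hsqrt := (CFC.continuousOn_sqrt _ (Matrix.posSemidef_gram ℝ w).nonneg).tendsto.comp hgram
  refine ((PiLp.continuous_toLp 2 _).tendsto _).comp (tendsto_pi_nhds.2 fun k => ?_)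
  exact tendsto_pi_nhds.1 (tendsto_pi_nhds.1 hsqrt k) i

theorem exists_linearIsometry_dist_eq_dist_gramRoot (y w : ι → L2Seq) :
    ∃ Φ Ψ : L2Seq →ₗᵢ[ℝ] L2Seq,
      ∀ i, dist (Φ (y i)) (Ψ (w i)) = dist (gramRoot y i) (gramRoot w i) := by
  obtain ⟨J⟩ := nonempty_linearIsometry_l2Seq (WithLp 2 (EuclideanSpace ℝ ι × L2Seq))
  obtain ⟨Φ, hΦ⟩ := exists_linearIsometry_of_inner_eq fun i j => (inner_gramRoot y i j).symm
  obtain ⟨Ψ, hΨ⟩ := exists_linearIsometry_of_inner_eq fun i j => (inner_gramRoot w i j).symm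
  refine ⟨J.comp Φ, J.comp Ψ, fun i => ?_⟩
  simp [hΦ, hΨ]

theorem Shape.hdist_mk_le_of_net {K L : NonemptyCompacts L2Seq} {y w : ι → L2Seq} {r δ : ℝ}
    (hyK : ∀ i, y i ∈ K) (hKy : ∀ x ∈ K, ∃ i, dist x (y i) ≤ r)
    (hwL : ∀ i, w i ∈ L) (hLw : ∀ x ∈ L, ∃ i, dist x (w i) ≤ r)
    (h : ∀ i, dist (gramRoot y i) (gramRoot w i) ≤ δ) :
    Shape.hdist (Shape.mk K) (Shape.mk L) ≤ r + δ := by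
  obtain ⟨Φ, Ψ, hΦΨ⟩ := exists_linearIsometry_dist_eq_dist_gramRoot y w
  obtain ⟨x, hx⟩ := K.nonempty
  obtain ⟨i, hi⟩ := hKy x hx
  have hnonneg : 0 ≤ r + δ := add_nonneg (dist_nonneg.trans hi) (dist_nonneg.trans (h i))
  rw [← Shape.mk_map K Φ.isometry, ← Shape.mk_map L Ψ.isometry]
  refine (Shape.hdist_mk_le _ _).trans ?_
  rw [Metric.NonemptyCompacts.dist_eq]
  refine Metric.hausdorffDist_le_of_mem_dist hnonneg ?_ ?_
  · rintro _ ⟨x, hx, rfl⟩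
    obtain ⟨i, hi⟩ := hKy x hx
    refine ⟨Ψ (w i), Set.mem_image_of_mem Ψ (hwL i), (dist_triangle _ (Φ (y i)) _).trans ?_⟩
    rw [Φ.dist_map, hΦΨ]
    exact add_le_add hi (h i)
  · rintro _ ⟨x, hx, rfl⟩
    obtain ⟨i, hi⟩ := hLw x hx
    refine ⟨Φ (y i), Set.mem_image_of_mem Φ (hyK i), (dist_triangle _ (Ψ (w i)) _).trans ?_⟩
    rw [Ψ.dist_map, dist_comm (Ψ (w i)), hΦΨ]
    exact add_le_add hi (h i)

end GramMatrix

/-! ### A law of large numbers for squared norms of sums -/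

theorem memLp_two_of_integral_norm_sq_ne_zero {Ω E : Type*} [MeasurableSpace Ω] {P : Measure Ω}
    [NormedAddCommGroup E] {Z : Ω → E} (hZ : AEStronglyMeasurable Z P)
    (h : ∫ ω, ‖Z ω‖ ^ 2 ∂P ≠ 0) : MemLp Z 2 P :=
  (memLp_two_iff_integrable_sq_norm hZ).2 (.of_integral_ne_zero h)

section Increments

variable {Ω ι E : Type*} [NormedAddCommGroup E] [InnerProductSpace ℝ E]

/-- The sum `∑_{i ≠ j} ⟪X i, X j⟫` over `i, j ∈ s`. -/
def crossSum (X : ι → Ω → E) (s : Finset ι) (ω : Ω) : ℝ :=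
  ‖∑ i ∈ s, X i ω‖ ^ 2 - ∑ i ∈ s, ‖X i ω‖ ^ 2

theorem crossSum_insert {X : ι → Ω → E} {s : Finset ι} {a : ι} [DecidableEq ι] (ha : a ∉ s)
    (ω : Ω) :
    crossSum X (insert a s) ω = crossSum X s ω + 2 * inner ℝ (∑ i ∈ s, X i ω) (X a ω) := by
  rw [crossSum, crossSum, Finset.sum_insert ha, Finset.sum_insert ha, add_comm (X a ω),
    norm_add_sq_real]
  ring

theorem integral_abs_le_sqrt_integral_sq [MeasurableSpace Ω] {P : Measure Ω}
    [IsProbabilityMeasure P] {f : Ω → ℝ} (hf : MemLp f 2 P) :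
    ∫ ω, |f ω| ∂P ≤ √(∫ ω, f ω ^ 2 ∂P) := by
  refine Real.le_sqrt_of_sq_le ?_
  have h := variance_nonneg |f| P
  rw [variance_eq_sub hf.abs] at h
  simpa using h

variable [MeasurableSpace Ω] {P : Measure Ω} [MeasurableSpace E] [BorelSpace E]

theorem integral_inner_eq_zero [CompleteSpace E] {U Z : Ω → E} (h : IndepFun U Z P)
    (hU : Integrable U P) (hZ : Integrable Z P) (hZ0 : ∫ ω, Z ω ∂P = 0) :
    ∫ ω, inner ℝ (U ω) (Z ω) ∂P = 0 := by
  refine (h.integral_bilin hU hZ (innerSL ℝ)).trans ?_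
  rw [hZ0, map_zero]

theorem integrable_inner_sq {U Z : Ω → E} (h : IndepFun U Z P) (hU : MemLp U 2 P)
    (hZ : MemLp Z 2 P) : Integrable (fun ω => inner ℝ (U ω) (Z ω) ^ 2) P := by
  have hnorm : IndepFun (fun ω => ‖U ω‖ ^ 2) (fun ω => ‖Z ω‖ ^ 2) P :=
    h.comp (φ := fun z => ‖z‖ ^ 2) (ψ := fun z => ‖z‖ ^ 2) (by fun_prop) (by fun_prop)
  refine (hnorm.integrable_mul hU.norm.integrable_sq hZ.norm.integrable_sq).mono'
    ((hU.1.inner hZ.1).pow 2) (.of_forall fun ω => ?_)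
  rw [Pi.mul_apply, ← mul_pow, Real.norm_eq_abs, abs_pow]
  gcongr
  exact abs_real_inner_le_norm _ _

theorem integral_inner_sq_le [IsProbabilityMeasure P] [SecondCountableTopology E] {U Z : Ω → E}
    {v : ℝ} (h : IndepFun U Z P) (hU : MemLp U 2 P)
    (hZ : MemLp Z 2 P) (hv : ∀ u, ∫ ω, inner ℝ u (Z ω) ^ 2 ∂P ≤ v * ‖u‖ ^ 2) :
    ∫ ω, inner ℝ (U ω) (Z ω) ^ 2 ∂P ≤ v * ∫ ω, ‖U ω‖ ^ 2 ∂P := by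
  have hUm := hU.1.aemeasurable
  have hZm := hZ.1.aemeasurable
  have hmap := (indepFun_iff_map_prod_eq_prod_map_map hUm hZm).1 h
  have hcont : Continuous fun p : E × E => inner ℝ p.1 p.2 ^ 2 := by fun_prop
  have hint : Integrable (fun p : E × E => inner ℝ p.1 p.2 ^ 2) ((P.map U).prod (P.map Z)) := by
    rw [← hmap, integrable_map_measure hcont.aestronglyMeasurable (hUm.prodMk hZm)]
    exact integrable_inner_sq h hU hZ
  calc ∫ ω, inner ℝ (U ω) (Z ω) ^ 2 ∂P
      = ∫ p, inner ℝ p.1 p.2 ^ 2 ∂((P.map U).prod (P.map Z)) := by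
        rw [← hmap, integral_map (hUm.prodMk hZm) hcont.aestronglyMeasurable]
    _ = ∫ u, ∫ z, inner ℝ u z ^ 2 ∂(P.map Z) ∂(P.map U) := integral_prod _ hint
    _ = ∫ ω, ∫ ω', inner ℝ (U ω) (Z ω') ^ 2 ∂P ∂P := by
        rw [integral_map hUm hint.integral_prod_left.1]
        refine integral_congr_ae (.of_forall fun ω => integral_map hZm ?_)
        exact Continuous.aestronglyMeasurable (by fun_prop)
    _ ≤ ∫ ω, v * ‖U ω‖ ^ 2 ∂P :=
        integral_mono_of_nonneg (.of_forall fun ω => integral_nonneg fun ω' => sq_nonneg _)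
          (hU.norm.integrable_sq.const_mul v) (.of_forall fun ω => hv (U ω))
    _ = v * ∫ ω, ‖U ω‖ ^ 2 ∂P := integral_const_mul _ _

/-- Independent centered random vectors with `𝔼 ‖X i‖² = 1` and with covariance operators of norm
at most `v`. -/
structure IsNormalizedIncrements (P : Measure Ω) (X : ι → Ω → E) (v : ℝ) : Prop where
  measurable : ∀ i, Measurable (X i)
  indep : iIndepFun X P
  integral_eq_zero : ∀ i, ∫ ω, X i ω ∂P = 0
  integral_norm_sq : ∀ i, ∫ ω, ‖X i ω‖ ^ 2 ∂P = 1
  integral_inner_sq_le : ∀ i u, ∫ ω, inner ℝ u (X i ω) ^ 2 ∂P ≤ v * ‖u‖ ^ 2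

namespace IsNormalizedIncrements

variable [SecondCountableTopology E] {X : ι → Ω → E} {v : ℝ}

theorem memLp (hX : IsNormalizedIncrements P X v) (i : ι) : MemLp (X i) 2 P :=
  memLp_two_of_integral_norm_sq_ne_zero (hX.measurable i).aestronglyMeasurable
    (hX.integral_norm_sq i ▸ one_ne_zero)

theorem memLp_sum (hX : IsNormalizedIncrements P X v) (s : Finset ι) :
    MemLp (fun ω => ∑ i ∈ s, X i ω) 2 P :=
  memLp_finsetSum s fun i _ => hX.memLp i

theorem indepFun_crossSum (hX : IsNormalizedIncrements P X v) {s : Finset ι} {a : ι}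
    (ha : a ∉ s) : IndepFun (fun ω => (crossSum X s ω, ∑ i ∈ s, X i ω)) (X a) P := by
  have heval : Measurable fun y : ({a} : Finset ι) → E => y ⟨a, Finset.mem_singleton_self a⟩ :=
    measurable_pi_apply _
  have h := (hX.indep.indepFun_finset s {a} (Finset.disjoint_singleton_right.2 ha)
    hX.measurable).comp
    (φ := fun y : s → E => (‖∑ i, y i‖ ^ 2 - ∑ i, ‖y i‖ ^ 2, ∑ i, y i)) (by fun_prop) heval
  convert! h using 1
  funext ω
  simp only [Function.comp_apply, crossSum]
  rw [Finset.sum_coe_sort s fun i => X i ω, Finset.sum_coe_sort s fun i => ‖X i ω‖ ^ 2]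

theorem indepFun_sum (hX : IsNormalizedIncrements P X v) {s : Finset ι} {a : ι} (ha : a ∉ s) :
    IndepFun (fun ω => ∑ i ∈ s, X i ω) (X a) P :=
  (hX.indepFun_crossSum ha).comp measurable_snd measurable_id

theorem memLp_inner_sum (hX : IsNormalizedIncrements P X v) {s : Finset ι} {a : ι} (ha : a ∉ s) :
    MemLp (fun ω => inner ℝ (∑ i ∈ s, X i ω) (X a ω)) 2 P :=
  (memLp_two_iff_integrable_sq ((hX.memLp_sum s).1.inner (hX.memLp a).1)).2
    (integrable_inner_sq (hX.indepFun_sum ha) (hX.memLp_sum s) (hX.memLp a))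

theorem memLp_crossSum (hX : IsNormalizedIncrements P X v) (s : Finset ι) :
    MemLp (crossSum X s) 2 P := by
  classical
  induction s using Finset.induction_on with
  | empty =>
    have h0 : crossSum X ∅ = 0 := funext fun ω => by simp [crossSum]
    exact h0 ▸ MemLp.zero
  | insert a s ha ih =>
    rw [funext (crossSum_insert ha)]
    exact ih.add ((hX.memLp_inner_sum ha).const_mul 2)

variable [IsProbabilityMeasure P] [CompleteSpace E]

theorem integral_inner_sum (hX : IsNormalizedIncrements P X v) {s : Finset ι} {a : ι}
    (ha : a ∉ s) : ∫ ω, inner ℝ (∑ i ∈ s, X i ω) (X a ω) ∂P = 0 :=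
  integral_inner_eq_zero (hX.indepFun_sum ha) ((hX.memLp_sum s).integrable one_le_two)
    ((hX.memLp a).integrable one_le_two) (hX.integral_eq_zero a)

theorem integral_crossSum (hX : IsNormalizedIncrements P X v) (s : Finset ι) :
    ∫ ω, crossSum X s ω ∂P = 0 := by
  classical
  induction s using Finset.induction_on with
  | empty => simp [crossSum]
  | insert a s ha ih =>
    simp only [crossSum_insert ha]
    rw [integral_add ((hX.memLp_crossSum s).integrable one_le_two)
      (((hX.memLp_inner_sum ha).integrable one_le_two).const_mul 2), integral_const_mul, ih,
      hX.integral_inner_sum ha, mul_zero, add_zero]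

theorem integral_norm_sum_sq (hX : IsNormalizedIncrements P X v) (s : Finset ι) :
    ∫ ω, ‖∑ i ∈ s, X i ω‖ ^ 2 ∂P = s.card := by
  have hsq : ∀ i ∈ s, Integrable (fun ω => ‖X i ω‖ ^ 2) P := fun i _ =>
    (hX.memLp i).norm.integrable_sq
  have h := hX.integral_crossSum s
  simp only [crossSum] at h
  rw [integral_sub (hX.memLp_sum s).norm.integrable_sq (integrable_finsetSum s hsq),
    integral_finsetSum s hsq, sub_eq_zero] at h
  simpa [hX.integral_norm_sq] using h

theorem integral_crossSum_mul_inner_sum (hX : IsNormalizedIncrements P X v) {s : Finset ι} {a : ι}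
    (ha : a ∉ s) :
    ∫ ω, crossSum X s ω * inner ℝ (∑ i ∈ s, X i ω) (X a ω) ∂P = 0 := by
  have hind : IndepFun (fun ω => crossSum X s ω • ∑ i ∈ s, X i ω) (X a) P :=
    (hX.indepFun_crossSum ha).comp (φ := fun p : ℝ × E => p.1 • p.2) (by fun_prop) measurable_id
  have hint : Integrable (fun ω => crossSum X s ω • ∑ i ∈ s, X i ω) P :=
    memLp_one_iff_integrable.1 ((hX.memLp_sum s).smul (hX.memLp_crossSum s))
  simpa only [real_inner_smul_left] using
    integral_inner_eq_zero hind hint ((hX.memLp a).integrable one_le_two) (hX.integral_eq_zero a)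

theorem integral_crossSum_sq_le (hX : IsNormalizedIncrements P X v) (s : Finset ι) :
    ∫ ω, crossSum X s ω ^ 2 ∂P ≤ 2 * v * (s.card * (s.card - 1)) := by
  classical
  induction s using Finset.induction_on with
  | empty => simp [crossSum]
  | insert a s ha ih =>
    have hC := hX.memLp_crossSum s
    have hT := hX.memLp_inner_sum ha
    have hexpand : ∀ ω, crossSum X (insert a s) ω ^ 2 = crossSum X s ω ^ 2 +
        4 * (crossSum X s ω * inner ℝ (∑ i ∈ s, X i ω) (X a ω)) +
        4 * inner ℝ (∑ i ∈ s, X i ω) (X a ω) ^ 2 := fun ω => by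
      rw [crossSum_insert ha]
      ring
    have hstep : ∫ ω, inner ℝ (∑ i ∈ s, X i ω) (X a ω) ^ 2 ∂P ≤ v * s.card := by
      rw [← hX.integral_norm_sum_sq]
      exact WienerSpiral.integral_inner_sq_le (hX.indepFun_sum ha) (hX.memLp_sum s) (hX.memLp a)
        (hX.integral_inner_sq_le a)
    have hCT : Integrable (fun ω => 4 * (crossSum X s ω * inner ℝ (∑ i ∈ s, X i ω) (X a ω))) P :=
      (hC.integrable_mul hT).const_mul 4
    have hsum : Integrable (fun ω => crossSum X s ω ^ 2 +
        4 * (crossSum X s ω * inner ℝ (∑ i ∈ s, X i ω) (X a ω))) P := hC.integrable_sq.add hCT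
    simp only [hexpand]
    rw [integral_add hsum (hT.integrable_sq.const_mul 4),
      integral_add hC.integrable_sq hCT, integral_const_mul, integral_const_mul,
      hX.integral_crossSum_mul_inner_sum ha, Finset.card_insert_of_notMem ha]
    push_cast
    linarith

theorem integral_abs_crossSum_le (hX : IsNormalizedIncrements P X v) (s : Finset ι) :
    ∫ ω, |crossSum X s ω| ∂P ≤ √(2 * |v|) * s.card := by
  refine (integral_abs_le_sqrt_integral_sq (hX.memLp_crossSum s)).trans ?_
  rw [← Real.sqrt_sq (Nat.cast_nonneg (α := ℝ) s.card), ← Real.sqrt_mul (by positivity)]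
  refine Real.sqrt_le_sqrt ((hX.integral_crossSum_sq_le s).trans ?_)
  have hn : (s.card : ℝ) ≤ s.card ^ 2 := by exact_mod_cast Nat.le_self_pow two_ne_zero _
  nlinarith [le_abs_self v, abs_nonneg v, Nat.cast_nonneg (α := ℝ) s.card]

end IsNormalizedIncrements

theorem abs_sum_sub_le_abs_sum_sub_add {y t p q : ι → ℝ} {η : ℝ} (s : Finset ι)
    (h : ∀ i ∈ s, |p i - q i| ≤ η) :
    |∑ i ∈ s, (y i - p i)| ≤ |∑ i ∈ s, (t i - q i)| + ∑ i ∈ s, (|y i - t i| + η) := by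
  have hsplit : ∑ i ∈ s, (y i - p i) =
      ∑ i ∈ s, (t i - q i) + ∑ i ∈ s, ((y i - t i) - (p i - q i)) := by
    rw [← Finset.sum_add_distrib]
    exact Finset.sum_congr rfl fun i _ => by ring
  rw [hsplit]
  refine (abs_add_le _ _).trans (add_le_add_right ?_ _)
  refine (Finset.abs_sum_le_sum_abs _ _).trans (Finset.sum_le_sum fun i hi => ?_)
  exact (abs_sub _ _).trans (add_le_add_right (h i hi) _)

variable [IsProbabilityMeasure P]

theorem integral_abs_sum_truncation_sub_le {Y : ι → Ω → ℝ} {A : ℝ} (hA : 0 ≤ A)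
    (hY : ∀ i, AEStronglyMeasurable (Y i) P) (hind : Pairwise fun i j => IndepFun (Y i) (Y j) P)
    (s : Finset ι) :
    ∫ ω, |∑ i ∈ s, (truncation (Y i) A ω - ∫ ω', truncation (Y i) A ω' ∂P)| ∂P ≤ A * √s.card := by
  have hmem : ∀ i, MemLp (truncation (Y i) A) 2 P := fun i => (hY i).memLp_truncation
  have hvar : ∀ i, variance (truncation (Y i) A) P ≤ A ^ 2 := fun i => by
    convert variance_le_sq_of_bounded (.of_forall fun ω => ?_) (hmem i).1.aemeasurable using 2
    · exact (by ring : A = (A - -A) / 2)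
    · exact abs_le.1 ((abs_truncation_le_bound _ _ _).trans_eq (abs_of_nonneg hA))
  have hmeas : Measurable ((Set.Ioc (-A) A).indicator id) :=
    measurable_id.indicator measurableSet_Ioc
  have hmean : ∫ ω, (∑ i ∈ s, truncation (Y i) A) ω ∂P =
      ∑ i ∈ s, ∫ ω, truncation (Y i) A ω ∂P := by
    simp only [Finset.sum_apply]
    exact integral_finsetSum s fun i _ => (hmem i).integrable one_le_two
  have hsum : MemLp (∑ i ∈ s, truncation (Y i) A) 2 P := memLp_finsetSum' s fun i _ => hmem i
  calc ∫ ω, |∑ i ∈ s, (truncation (Y i) A ω - ∫ ω', truncation (Y i) A ω' ∂P)| ∂P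
      = ∫ ω, |(∑ i ∈ s, truncation (Y i) A) ω - ∫ ω', (∑ i ∈ s, truncation (Y i) A) ω' ∂P| ∂P := by
        rw [hmean]
        simp only [Finset.sum_apply, Finset.sum_sub_distrib]
    _ ≤ √(variance (∑ i ∈ s, truncation (Y i) A) P) := by
        rw [variance_eq_integral hsum.1.aemeasurable]
        exact integral_abs_le_sqrt_integral_sq (hsum.sub (memLp_const _))
    _ ≤ √(s.card * A ^ 2) := by
        rw [IndepFun.variance_sum (fun i _ => hmem i) fun i _ j _ hij =>
          (hind hij).comp hmeas hmeas]
        exact Real.sqrt_le_sqrt ((Finset.sum_le_card_nsmul _ _ _ fun i _ => hvar i).trans_eq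
          (nsmul_eq_mul _ _))
    _ = A * √s.card := by
        rw [Real.sqrt_mul (Nat.cast_nonneg _), Real.sqrt_sq hA, mul_comm]

theorem integral_abs_sum_sub_le {Y : ι → Ω → ℝ} {A η : ℝ} (hA : 0 ≤ A)
    (hY : ∀ i, Integrable (Y i) P) (hind : Pairwise fun i j => IndepFun (Y i) (Y j) P)
    (hη : ∀ i, ∫ ω, |Y i ω - truncation (Y i) A ω| ∂P ≤ η) (s : Finset ι) :
    ∫ ω, |∑ i ∈ s, (Y i ω - ∫ ω', Y i ω' ∂P)| ∂P ≤ A * √s.card + 2 * η * s.card := by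
  have hT : ∀ i, Integrable (truncation (Y i) A) P := fun i => (hY i).1.integrable_truncation
  have hR : ∀ i, Integrable (fun ω => Y i ω - truncation (Y i) A ω) P := fun i =>
    (hY i).sub (hT i)
  have hmean : ∀ i, |∫ ω, Y i ω ∂P - ∫ ω, truncation (Y i) A ω ∂P| ≤ η := fun i => by
    rw [← integral_sub (hY i) (hT i)]
    exact abs_integral_le_integral_abs.trans (hη i)
  have hT' : Integrable (fun ω => |∑ i ∈ s, (truncation (Y i) A ω -
      ∫ ω', truncation (Y i) A ω' ∂P)|) P :=
    (integrable_finsetSum s fun i _ => (hT i).sub (integrable_const _)).abs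
  have hR' : ∀ i ∈ s, Integrable (fun ω => |Y i ω - truncation (Y i) A ω| + η) P := fun i _ =>
    (hR i).abs.add (integrable_const _)
  calc ∫ ω, |∑ i ∈ s, (Y i ω - ∫ ω', Y i ω' ∂P)| ∂P
      ≤ ∫ ω, |∑ i ∈ s, (truncation (Y i) A ω - ∫ ω', truncation (Y i) A ω' ∂P)| ∂P +
          ∑ i ∈ s, ∫ ω, (|Y i ω - truncation (Y i) A ω| + η) ∂P := by
        rw [← integral_finsetSum s hR', ← integral_add hT' (integrable_finsetSum s hR')]
        exact integral_mono_of_nonneg (.of_forall fun ω => abs_nonneg _)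
          (hT'.add (integrable_finsetSum s hR')) (.of_forall fun ω =>
            abs_sum_sub_le_abs_sum_sub_add s fun i _ => hmean i)
    _ ≤ A * √s.card + ∑ i ∈ s, 2 * η := by
        gcongr with i
        · exact integral_abs_sum_truncation_sub_le hA (fun i => (hY i).1) hind s
        · rw [integral_add (hR i).abs (integrable_const _)]
          simpa [two_mul] using hη i
    _ = A * √s.card + 2 * η * s.card := by
        rw [Finset.sum_const, nsmul_eq_mul, mul_comm (2 * η)]

variable [CompleteSpace E] [SecondCountableTopology E]

theorem IsNormalizedIncrements.integral_abs_norm_sum_sq_sub_card_le {X : ι → Ω → E} {v A η : ℝ}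
    (hX : IsNormalizedIncrements P X v) (hA : 0 ≤ A)
    (hη : ∀ i, ∫ ω, |‖X i ω‖ ^ 2 - truncation (fun ω => ‖X i ω‖ ^ 2) A ω| ∂P ≤ η) (s : Finset ι) :
    ∫ ω, |‖∑ i ∈ s, X i ω‖ ^ 2 - s.card| ∂P ≤
      √(2 * |v|) * s.card + (A * √s.card + 2 * η * s.card) := by
  have hsq : ∀ i, Integrable (fun ω => ‖X i ω‖ ^ 2) P := fun i => (hX.memLp i).norm.integrable_sq
  have hind : Pairwise fun i j => IndepFun (fun ω => ‖X i ω‖ ^ 2) (fun ω => ‖X j ω‖ ^ 2) P :=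
    fun i j hij => (hX.indep.indepFun hij).comp (φ := fun x => ‖x‖ ^ 2) (ψ := fun x => ‖x‖ ^ 2)
      (by fun_prop) (by fun_prop)
  have hsplit : ∀ ω, |‖∑ i ∈ s, X i ω‖ ^ 2 - s.card| ≤ |crossSum X s ω| +
      |∑ i ∈ s, (‖X i ω‖ ^ 2 - ∫ ω', ‖X i ω'‖ ^ 2 ∂P)| := fun ω => by
    refine le_trans (le_of_eq ?_) (abs_add_le _ _)
    simp [crossSum, hX.integral_norm_sq]
  have hcross : Integrable (fun ω => |crossSum X s ω|) P :=
    ((hX.memLp_crossSum s).integrable one_le_two).abs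
  have hdiag : Integrable (fun ω => |∑ i ∈ s, (‖X i ω‖ ^ 2 - ∫ ω', ‖X i ω'‖ ^ 2 ∂P)|) P :=
    (integrable_finsetSum s fun i _ => (hsq i).sub (integrable_const _)).abs
  calc ∫ ω, |‖∑ i ∈ s, X i ω‖ ^ 2 - s.card| ∂P
      ≤ ∫ ω, |crossSum X s ω| ∂P + ∫ ω, |∑ i ∈ s, (‖X i ω‖ ^ 2 - ∫ ω', ‖X i ω'‖ ^ 2 ∂P)| ∂P := by
        rw [← integral_add hcross hdiag]
        exact integral_mono_of_nonneg (.of_forall fun ω => abs_nonneg _) (hcross.add hdiag)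
          (.of_forall hsplit)
    _ ≤ √(2 * |v|) * s.card + (A * √s.card + 2 * η * s.card) :=
        add_le_add (hX.integral_abs_crossSum_le s) (integral_abs_sum_sub_le hA hsq hind hη s)

end Increments

/-! ### The maximal inequality -/

namespace IsNormalizedIncrements

theorem comp_injective {Ω E ι κ : Type*} [MeasurableSpace Ω] {P : Measure Ω}
    [NormedAddCommGroup E] [InnerProductSpace ℝ E] [MeasurableSpace E] {X : ι → Ω → E} {v : ℝ}
    (hX : IsNormalizedIncrements P X v) {g : κ → ι} (hg : Function.Injective g) :
    IsNormalizedIncrements P (fun i => X (g i)) v where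
  measurable i := hX.measurable (g i)
  indep := hX.indep.precomp hg
  integral_eq_zero i := hX.integral_eq_zero (g i)
  integral_norm_sq i := hX.integral_norm_sq (g i)
  integral_inner_sq_le i := hX.integral_inner_sq_le (g i)

variable {Ω E : Type*} [MeasurableSpace Ω] {P : Measure Ω} [IsProbabilityMeasure P]
  [NormedAddCommGroup E] [InnerProductSpace ℝ E] [CompleteSpace E] [MeasurableSpace E]
  [BorelSpace E] [SecondCountableTopology E] {X : ℕ → Ω → E} {v : ℝ}

theorem setIntegral_norm_sum_range_sq_le_succ (hX : IsNormalizedIncrements P X v) (k : ℕ)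
    {A : Set Ω} (hA : MeasurableSet[Filtration.natural X
      (fun i => (hX.measurable i).stronglyMeasurable) k] A) :
    ∫ ω in A, ‖∑ i ∈ Finset.range (k + 1), X i ω‖ ^ 2 ∂P ≤
      ∫ ω in A, ‖∑ i ∈ Finset.range (k + 1 + 1), X i ω‖ ^ 2 ∂P := by
  let 𝓕 := Filtration.natural X fun i => (hX.measurable i).stronglyMeasurable
  have hAm : MeasurableSet A := 𝓕.le k _ hA
  have hsum := hX.memLp_sum (Finset.range (k + 1))
  have hinner := hX.memLp_inner_sum (Finset.notMem_range_self (n := k + 1))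
  have hmeas : Measurable[𝓕 k] (A.indicator fun ω => ∑ i ∈ Finset.range (k + 1), X i ω) := by
    refine Measurable.indicator (Finset.measurable_sum _ fun i hi => ?_) hA
    exact ((Filtration.stronglyAdapted_natural _ i).mono
      (𝓕.mono (Finset.mem_range_succ_iff.1 hi))).measurable
  have hind : IndepFun (A.indicator fun ω => ∑ i ∈ Finset.range (k + 1), X i ω) (X (k + 1)) P :=
    indep_of_indep_of_le_left (hX.indep.indep_comap_natural_of_lt
      (fun i => (hX.measurable i).stronglyMeasurable) k.lt_succ_self).symm hmeas.comap_le
  have hcross : ∫ ω in A, inner ℝ (∑ i ∈ Finset.range (k + 1), X i ω) (X (k + 1) ω) ∂P = 0 := by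
    rw [← integral_indicator hAm, ← integral_inner_eq_zero hind
      ((hsum.integrable one_le_two).indicator hAm) ((hX.memLp (k + 1)).integrable one_le_two)
      (hX.integral_eq_zero (k + 1))]
    congr 1
    funext ω
    by_cases hω : ω ∈ A <;> simp [hω]
  calc ∫ ω in A, ‖∑ i ∈ Finset.range (k + 1), X i ω‖ ^ 2 ∂P
      = ∫ ω in A, (‖∑ i ∈ Finset.range (k + 1), X i ω‖ ^ 2 +
          2 * inner ℝ (∑ i ∈ Finset.range (k + 1), X i ω) (X (k + 1) ω)) ∂P := by
        rw [integral_add hsum.norm.integrable_sq.integrableOn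
          ((hinner.integrable one_le_two).const_mul 2).integrableOn, integral_const_mul, hcross,
          mul_zero, add_zero]
    _ ≤ ∫ ω in A, ‖∑ i ∈ Finset.range (k + 1 + 1), X i ω‖ ^ 2 ∂P := by
        refine setIntegral_mono
          (hsum.norm.integrable_sq.add ((hinner.integrable one_le_two).const_mul 2)).integrableOn
          (hX.memLp_sum _).norm.integrable_sq.integrableOn fun ω => ?_
        rw [Finset.sum_range_succ _ (k + 1), norm_add_sq_real]
        exact le_add_of_nonneg_right (sq_nonneg _)

theorem submartingale_norm_sum_range_sq (hX : IsNormalizedIncrements P X v) :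
    Submartingale (fun k ω => ‖∑ i ∈ Finset.range (k + 1), X i ω‖ ^ 2)
      (Filtration.natural X fun i => (hX.measurable i).stronglyMeasurable) P := by
  refine submartingale_of_setIntegral_le_succ (fun k => ?_)
    (fun k => (hX.memLp_sum _).norm.integrable_sq)
    fun k A hA => hX.setIntegral_norm_sum_range_sq_le_succ k hA
  refine StronglyMeasurable.pow (StronglyMeasurable.norm ?_) 2
  exact Finset.stronglyMeasurable_fun_sum _ fun i hi =>
    (Filtration.stronglyAdapted_natural _ i).mono
      (Filtration.mono _ (Finset.mem_range_succ_iff.1 hi))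

theorem mul_measureReal_exists_le_norm_sum_range_sq_le (hX : IsNormalizedIncrements P X v)
    {c : ℝ} (hc : 0 < c) (m : ℕ) :
    c * P.real {ω | ∃ k ≤ m, c ≤ ‖∑ i ∈ Finset.range k, X i ω‖ ^ 2} ≤
      ∫ ω in {ω | ∃ k ≤ m, c ≤ ‖∑ i ∈ Finset.range k, X i ω‖ ^ 2},
        ‖∑ i ∈ Finset.range m, X i ω‖ ^ 2 ∂P := by
  lift c to NNReal using hc.le
  rcases m with _ | m
  · simp [hc.not_ge]
  have hset : {ω | ∃ k ≤ m + 1, c ≤ ‖∑ i ∈ Finset.range k, X i ω‖ ^ 2} =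
      {ω | c ≤ (Finset.range (m + 1)).sup' Finset.nonempty_range_add_one
        fun k => ‖∑ i ∈ Finset.range (k + 1), X i ω‖ ^ 2} := by
    ext ω
    simp only [Set.mem_ofPred_eq, Finset.le_sup'_iff, Finset.mem_range]
    refine ⟨fun ⟨k, hk, h⟩ => ?_, fun ⟨k, hk, h⟩ => ⟨k + 1, hk, h⟩⟩
    rcases k with _ | k
    · simp [hc.not_ge] at h
    · exact ⟨k, hk, h⟩
  have hmax := ENNReal.toReal_mono ENNReal.ofReal_ne_top
    (maximal_ineq hX.submartingale_norm_sum_range_sq (fun k ω => sq_nonneg _) (ε := c) m)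
  rwa [← hset, ENNReal.toReal_ofReal (integral_nonneg fun ω => sq_nonneg _),
    ENNReal.toReal_mul] at hmax

theorem sub_mul_measureReal_exists_le_norm_sum_range_sq (hX : IsNormalizedIncrements P X v)
    {c : ℝ} (hc : 0 < c) (m : ℕ) :
    (c - m) * P.real {ω | ∃ k ≤ m, c ≤ ‖∑ i ∈ Finset.range k, X i ω‖ ^ 2} ≤
      ∫ ω, |‖∑ i ∈ Finset.range m, X i ω‖ ^ 2 - m| ∂P := by
  have hmax := hX.mul_measureReal_exists_le_norm_sum_range_sq_le hc m
  set A := {ω | ∃ k ≤ m, c ≤ ‖∑ i ∈ Finset.range k, X i ω‖ ^ 2}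
  have hsq := (hX.memLp_sum (Finset.range m)).norm.integrable_sq
  have hdiff : Integrable (fun ω => ‖∑ i ∈ Finset.range m, X i ω‖ ^ 2 - m) P :=
    hsq.sub (integrable_const _)
  calc (c - m) * P.real A
      ≤ ∫ ω in A, (‖∑ i ∈ Finset.range m, X i ω‖ ^ 2 - m) ∂P := by
        rw [integral_sub hsq.integrableOn (integrable_const _).integrableOn, setIntegral_const,
          smul_eq_mul]
        linarith
    _ ≤ ∫ ω in A, |‖∑ i ∈ Finset.range m, X i ω‖ ^ 2 - m| ∂P :=
        setIntegral_mono hdiff.integrableOn hdiff.abs.integrableOn fun ω => le_abs_self _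
    _ ≤ ∫ ω, |‖∑ i ∈ Finset.range m, X i ω‖ ^ 2 - m| ∂P :=
        setIntegral_le_integral hdiff.abs (.of_forall fun ω => abs_nonneg _)

theorem sub_mul_measureReal_exists_le_norm_sum_Ico_sq (hX : IsNormalizedIncrements P X v)
    {c : ℝ} (hc : 0 < c) (a m : ℕ) :
    (c - m) * P.real {ω | ∃ k ≤ m, c ≤ ‖∑ i ∈ Finset.Ico a (a + k), X i ω‖ ^ 2} ≤
      ∫ ω, |‖∑ i ∈ Finset.Ico a (a + m), X i ω‖ ^ 2 - m| ∂P := by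
  simpa only [Finset.sum_Ico_eq_sum_range, add_tsub_cancel_left] using
    (hX.comp_injective (add_right_injective a)).sub_mul_measureReal_exists_le_norm_sum_range_sq
      hc m

end IsNormalizedIncrements

/-! ### Events of high probability -/

section HighProb

variable {α : Type*} {Ω : α → Type*} [∀ a, MeasurableSpace (Ω a)] {P : ∀ a, Measure (Ω a)}
  {l : Filter α}

/-- The filter on the union of the probability spaces `Ω a` of the events whose complements have
probabilities tending to `0` along `l`. Convergence along it is convergence in probability. -/
def highProb (P : ∀ a, Measure (Ω a)) (l : Filter α) : Filter (Σ a, Ω a) where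
  sets := {A | Tendsto (fun a => P a {ω | ⟨a, ω⟩ ∉ A}) l (𝓝 0)}
  univ_sets := by simpa using tendsto_const_nhds
  sets_of_superset hA hAB := tendsto_of_tendsto_of_tendsto_of_le_of_le tendsto_const_nhds hA
    (fun _ => zero_le) fun _ => measure_mono fun _ hω hA => hω (hAB hA)
  inter_sets {A B} hA hB := by
    refine tendsto_of_tendsto_of_tendsto_of_le_of_le tendsto_const_nhds
      (by simpa only [add_zero] using hA.add hB) (fun _ => zero_le)
      fun a => (measure_mono fun ω hω => ?_).trans (measure_union_le _ _)
    exact not_and_or.1 hω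

theorem eventually_highProb {p : (Σ a, Ω a) → Prop} :
    (∀ᶠ z in highProb P l, p z) ↔ Tendsto (fun a => P a {ω | ¬ p ⟨a, ω⟩}) l (𝓝 0) :=
  Iff.rfl

theorem eventually_highProb_iff_measureReal [∀ a, IsFiniteMeasure (P a)]
    {p : (Σ a, Ω a) → Prop} :
    (∀ᶠ z in highProb P l, p z) ↔ Tendsto (fun a => (P a).real {ω | ¬ p ⟨a, ω⟩}) l (𝓝 0) := by
  rw [eventually_highProb,
    ← ENNReal.tendsto_toReal_iff (fun a => measure_ne_top _ _) ENNReal.zero_ne_top]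
  rfl

theorem tendsto_fst_highProb : Tendsto Sigma.fst (highProb P l) l := by
  refine fun s hs => eventually_highProb.2 (tendsto_const_nhds.congr' ?_)
  filter_upwards [hs] with a ha
  simp [ha]

theorem tendsto_highProb_of_tendsto_integral_abs [∀ a, IsFiniteMeasure (P a)]
    {f : (Σ a, Ω a) → ℝ} (hf : ∀ᶠ a in l, Integrable (fun ω => f ⟨a, ω⟩) (P a))
    (h : Tendsto (fun a => ∫ ω, |f ⟨a, ω⟩| ∂(P a)) l (𝓝 0)) :
    Tendsto f (highProb P l) (𝓝 0) := by
  refine Metric.tendsto_nhds.2 fun ε hε => eventually_highProb_iff_measureReal.2 ?_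
  refine squeeze_zero' (.of_forall fun a => measureReal_nonneg) ?_
    (by simpa only [zero_div] using h.div_const ε)
  filter_upwards [hf] with a ha
  rw [le_div_iff₀' hε]
  simpa only [Real.dist_eq, sub_zero, not_lt] using
    mul_meas_ge_le_integral_of_nonneg (.of_forall fun ω => abs_nonneg _) ha.abs ε

end HighProb

/-! ### Triangular arrays -/

section Array

variable {α ι : Type*} {Ω : α → Type*} [∀ a, MeasurableSpace (Ω a)] {P : ∀ a, Measure (Ω a)}
  {E : α → Type*} [∀ a, NormedAddCommGroup (E a)] [∀ a, InnerProductSpace ℝ (E a)]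
  [∀ a, MeasurableSpace (E a)] {l : Filter α}

/-- Families of normalized increments whose covariance operators tend to `0` in norm and whose
squared norms are uniformly integrable. The latter is expressed through `truncation`, which sets a
function to `0` where its absolute value is large. -/
structure IsNegligibleArray (P : ∀ a, Measure (Ω a)) (X : ∀ a, ι → Ω a → E a) (v : α → ℝ)
    (l : Filter α) : Prop where
  increments : ∀ᶠ a in l, IsNormalizedIncrements (P a) (X a) (v a)
  tendsto_zero : Tendsto v l (𝓝 0)
  exists_truncation : ∀ η : ℝ, 0 < η → ∃ A : ℝ, 0 ≤ A ∧ ∀ᶠ a in l, ∀ i,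
    ∫ ω, |‖X a i ω‖ ^ 2 - truncation (fun ω => ‖X a i ω‖ ^ 2) A ω| ∂(P a) ≤ η

namespace IsNegligibleArray

variable [∀ a, IsProbabilityMeasure (P a)] [∀ a, CompleteSpace (E a)] [∀ a, BorelSpace (E a)]
  [∀ a, SecondCountableTopology (E a)] {v : α → ℝ} {n : α → ℕ} {t : ℝ}

section Sums

variable {X : ∀ a, ι → Ω a → E a} {s : α → Finset ι}

theorem tendsto_integral_abs_norm_sum_sq_sub_card_div (hX : IsNegligibleArray P X v l)
    (hn : Tendsto n l atTop) (hs : Tendsto (fun a => (s a).card / n a : α → ℝ) l (𝓝 t)) :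
    Tendsto (fun a => (∫ ω, |‖∑ i ∈ s a, X a i ω‖ ^ 2 - (s a).card| ∂(P a)) / n a) l (𝓝 0) := by
  refine Metric.tendsto_nhds.2 fun ε hε => ?_
  obtain ⟨A, hA, htail⟩ := hX.exists_truncation (ε / (2 * (|t| + 1))) (by positivity)
  set η := ε / (2 * (|t| + 1)) with hη
  have hn' : Tendsto (fun a => (√(n a : ℝ))⁻¹) l (𝓝 0) :=
    (Real.tendsto_sqrt_atTop.comp (tendsto_natCast_atTop_atTop.comp hn)).inv_tendsto_atTop
  have hv : Tendsto (fun a => √(2 * |v a|)) l (𝓝 0) := by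
    simpa using (hX.tendsto_zero.abs.const_mul 2).sqrt
  have hlim : Tendsto (fun a => √(2 * |v a|) * ((s a).card / n a) +
      (A * (√((s a).card / n a : ℝ) * (√(n a : ℝ))⁻¹) + 2 * η * ((s a).card / n a))) l
      (𝓝 (2 * η * t)) := by
    simpa using (hv.mul hs).add (((hs.sqrt.mul hn').const_mul A).add (hs.const_mul (2 * η)))
  have hlt : 2 * η * t < ε := by
    refine (mul_le_mul_of_nonneg_left (le_abs_self t) (by positivity)).trans_lt ?_
    rw [hη, show 2 * (ε / (2 * (|t| + 1))) * |t| = ε * (|t| / (|t| + 1)) by field_simp]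
    exact mul_lt_of_lt_one_right hε ((div_lt_one (by positivity)).2 (lt_add_one _))
  filter_upwards [hX.increments, htail, hlim.eventually_lt_const hlt,
    hn.eventually_ge_atTop 1] with a hinc hη' hε' hna
  have hna' : (0 : ℝ) < n a := Nat.cast_pos.2 hna
  rw [Real.dist_eq, sub_zero, abs_of_nonneg (by positivity)]
  refine lt_of_le_of_lt ?_ hε'
  rw [div_le_iff₀ hna']
  refine (hinc.integral_abs_norm_sum_sq_sub_card_le hA hη' (s a)).trans_eq ?_
  have hsqrt : √(n a : ℝ) ^ 2 = n a := Real.sq_sqrt hna'.le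
  rw [Real.sqrt_div (Nat.cast_nonneg _)]
  field_simp
  rw [hsqrt]
  ring

theorem tendsto_norm_sum_sq_div (hX : IsNegligibleArray P X v l)
    (hn : Tendsto n l atTop) (hs : Tendsto (fun a => (s a).card / n a : α → ℝ) l (𝓝 t)) :
    Tendsto (fun z => ‖∑ i ∈ s z.1, X z.1 i z.2‖ ^ 2 / n z.1 : (Σ a, Ω a) → ℝ)
      (highProb P l) (𝓝 t) := by
  have h : Tendsto (fun z => (‖∑ i ∈ s z.1, X z.1 i z.2‖ ^ 2 - (s z.1).card) / n z.1 :
      (Σ a, Ω a) → ℝ) (highProb P l) (𝓝 0) := by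
    refine tendsto_highProb_of_tendsto_integral_abs ?_ ?_
    · filter_upwards [hX.increments] with a ha
      exact ((ha.memLp_sum (s a)).norm.integrable_sq.sub (integrable_const _)).div_const _
    · simpa only [abs_div, Nat.abs_cast, integral_div] using
        hX.tendsto_integral_abs_norm_sum_sq_sub_card_div hn hs
  simpa only [Function.comp_apply, ← add_div, sub_add_cancel, zero_add] using
    h.add (hs.comp tendsto_fst_highProb)

end Sums

theorem eventually_forall_norm_sum_Ico_sq_lt {X : ∀ a, ℕ → Ω a → E a}
    (hX : IsNegligibleArray P X v l) (hn : Tendsto n l atTop) (j : α → ℕ) {m : α → ℕ}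
    (hm : Tendsto (fun a => m a / n a : α → ℝ) l (𝓝 t)) {c : ℝ} (hc : t < c) :
    ∀ᶠ z in highProb P l, ∀ k ≤ m z.1,
      ‖∑ i ∈ Finset.Ico (j z.1) (j z.1 + k), X z.1 i z.2‖ ^ 2 < c * n z.1 := by
  have hint := hX.tendsto_integral_abs_norm_sum_sq_sub_card_div hn
    (s := fun a => Finset.Ico (j a) (j a + m a)) (by simpa using hm)
  have hlim := hint.div (hm.const_sub c) (sub_pos.2 hc).ne'
  rw [zero_div] at hlim
  refine eventually_highProb_iff_measureReal.2
    (squeeze_zero' (.of_forall fun a => measureReal_nonneg) ?_ hlim)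
  filter_upwards [hX.increments, hm.eventually_lt_const hc, hn.eventually_ge_atTop 1]
    with a hinc hmc hna
  have hna' : (0 : ℝ) < n a := Nat.cast_pos.2 hna
  have hc0 : 0 < c := (by positivity : (0 : ℝ) ≤ m a / n a).trans_lt hmc
  have hmax := hinc.sub_mul_measureReal_exists_le_norm_sum_Ico_sq (mul_pos hc0 hna') (j a) (m a)
  rw [Pi.div_apply, le_div_iff₀ (sub_pos.2 hmc), le_div_iff₀ hna', mul_assoc, sub_mul,
    div_mul_cancel₀ _ hna'.ne', mul_comm]
  simpa using hmax

end IsNegligibleArray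

end Array

/-! ### The rescaled walk near the Wiener spiral -/

/-- The point `S_k / √n` of the rescaled walk. -/
def walkPoint {d : ℕ} (n : ℕ) (x : ℕ → EuclideanSpace ℝ (Fin d)) (k : ℕ) : L2Seq :=
  embed d ((√(n : ℝ))⁻¹ • ∑ i ∈ Finset.range k, x i)

/-- The set of the points of the rescaled walk up to time `n`. -/
def walkSet {d : ℕ} (n : ℕ) (x : ℕ → EuclideanSpace ℝ (Fin d)) : NonemptyCompacts L2Seq where
  carrier := walkPoints n x
  isCompact' := ((Set.finite_Iic n).image _).isCompact
  nonempty' := Set.nonempty_Iic.image _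

theorem cch_walkSet {d : ℕ} (n : ℕ) (x : ℕ → EuclideanSpace ℝ (Fin d)) :
    cch (walkSet n x) = walkHull n x :=
  NonemptyCompacts.ext (walkHull n x).isCompact.isClosed.closure_eq

theorem embed_eq_sum {d : ℕ} (x : EuclideanSpace ℝ (Fin d)) :
    embed d x = ∑ i : Fin d, x i • (lp.single 2 (i : ℕ) (1 : ℝ) : L2Seq) := by
  refine Finset.sum_congr rfl fun i _ => ?_
  rw [← lp.single_smul, smul_eq_mul, mul_one]

theorem embed_sub {d : ℕ} (x y : EuclideanSpace ℝ (Fin d)) :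
    embed d (x - y) = embed d x - embed d y := by
  simp [embed_eq_sum, sub_smul]

theorem norm_embed {d : ℕ} (x : EuclideanSpace ℝ (Fin d)) : ‖embed d x‖ = ‖x‖ := by
  have he : Orthonormal ℝ fun l : Fin d => (lp.single 2 (l : ℕ) (1 : ℝ) : L2Seq) :=
    orthonormal_single.comp _ Fin.val_injective
  refine (sq_eq_sq₀ (norm_nonneg _) (norm_nonneg _)).1 ?_
  rw [embed_eq_sum, ← real_inner_self_eq_norm_sq, he.inner_sum, EuclideanSpace.real_norm_sq_eq]
  simp [sq]

theorem walkPoint_zero {d : ℕ} (n : ℕ) (x : ℕ → EuclideanSpace ℝ (Fin d)) :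
    walkPoint n x 0 = 0 := by
  simp [walkPoint, embed_eq_sum]

theorem norm_walkPoint_sub_sq {d : ℕ} (n : ℕ) (x : ℕ → EuclideanSpace ℝ (Fin d)) {j k : ℕ}
    (hjk : j ≤ k) :
    ‖walkPoint n x k - walkPoint n x j‖ ^ 2 = ‖∑ i ∈ Finset.Ico j k, x i‖ ^ 2 / n := by
  rw [walkPoint, walkPoint, ← embed_sub, norm_embed, ← smul_sub, norm_smul,
    ← Finset.sum_Ico_eq_sub _ hjk, mul_pow, norm_inv, Real.norm_of_nonneg (Real.sqrt_nonneg _),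
    inv_pow, Real.sq_sqrt n.cast_nonneg, inv_mul_eq_div]

theorem tendsto_floor_mul_sub_floor_mul_div {α : Type*} {l : Filter α} {n : α → ℕ}
    (hn : Tendsto n l atTop) {s t : ℝ} (hs : 0 ≤ s) (hst : s ≤ t) :
    Tendsto (fun a => ((⌊t * n a⌋₊ - ⌊s * n a⌋₊ : ℕ) : ℝ) / n a) l (𝓝 (t - s)) := by
  have hfloor : ∀ {u : ℝ}, 0 ≤ u → Tendsto (fun a => (⌊u * n a⌋₊ : ℝ) / n a) l (𝓝 u) :=
    fun hu => (tendsto_nat_floor_mul_div_atTop hu).comp (tendsto_natCast_atTop_atTop.comp hn)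
  refine ((hfloor (hs.trans hst)).sub (hfloor hs)).congr fun a => ?_
  rw [Nat.cast_sub (Nat.floor_mono (by gcongr)), sub_div]

theorem exists_floor_div_mul_le_le {k n N : ℕ} (hN : 0 < N) (hk : k ≤ n) :
    ∃ i : Fin (N + 1), ⌊(i / N : ℝ) * n⌋₊ ≤ k ∧ k ≤ ⌊((i + 1) / N : ℝ) * n⌋₊ := by
  rcases n.eq_zero_or_pos with rfl | hn
  · exact ⟨0, by simp_all⟩
  have hN' : (0 : ℝ) < N := Nat.cast_pos.2 hN
  have hiN : k * N / n ≤ N := Nat.div_le_of_le_mul (Nat.mul_le_mul_right N hk)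
  refine ⟨⟨k * N / n, Nat.lt_succ_of_le hiN⟩, Nat.floor_le_of_le ?_, Nat.le_floor ?_⟩
  · rw [div_mul_eq_mul_div, div_le_iff₀ hN']
    exact_mod_cast Nat.div_mul_le_self (k * N) n
  · rw [div_mul_eq_mul_div, le_div_iff₀ hN']
    exact_mod_cast (Nat.lt_mul_of_div_lt (Nat.lt_succ_self (k * N / n)) hn).le

theorem exists_dist_spiralPoint_div_sq_le {N : ℕ} (hN : 0 < N) {t : ℝ}
    (ht : t ∈ Set.Icc (0 : ℝ) 1) :
    ∃ i : Fin (N + 1), dist (spiralPoint t) (spiralPoint (i / N)) ^ 2 ≤ 1 / N := by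
  have hN' : (0 : ℝ) < N := Nat.cast_pos.2 hN
  have htN : ⌊t * N⌋₊ ≤ N := Nat.floor_le_of_le (mul_le_of_le_one_left hN'.le ht.2)
  refine ⟨⟨⌊t * N⌋₊, Nat.lt_succ_of_le htN⟩, ?_⟩
  rw [dist_eq_norm, norm_spiralPoint_sub_sq ht ⟨by positivity, div_le_one_of_le₀
    (Nat.cast_le.2 htN) hN'.le⟩, ← mul_div_cancel_right₀ t hN'.ne', ← sub_div, abs_div,
    abs_of_pos hN', mul_div_cancel_right₀ t hN'.ne']
  gcongr
  rw [abs_le]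
  constructor <;> linarith [Nat.floor_le (mul_nonneg ht.1 hN'.le), Nat.lt_floor_add_one (t * N)]

namespace IsNegligibleArray

variable {Ω : ℕ → Type*} [∀ d, MeasurableSpace (Ω d)] {P : ∀ d, Measure (Ω d)}
  [∀ d, IsProbabilityMeasure (P d)] {X : ∀ d, ℕ → Ω d → EuclideanSpace ℝ (Fin d)}
  {v : ℕ → ℝ} {l : Filter ℕ} {n : ℕ → ℕ}

theorem tendsto_norm_walkPoint_sub_sq (hX : IsNegligibleArray P X v l) (hn : Tendsto n l atTop)
    {s t : ℝ} (hs : 0 ≤ s) (hst : s ≤ t) :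
    Tendsto (fun z : Σ d, Ω d =>
        ‖walkPoint (n z.1) (fun i => X z.1 i z.2) ⌊t * n z.1⌋₊ -
          walkPoint (n z.1) (fun i => X z.1 i z.2) ⌊s * n z.1⌋₊‖ ^ 2)
      (highProb P l) (𝓝 (t - s)) := by
  refine (hX.tendsto_norm_sum_sq_div hn
    (s := fun d => Finset.Ico ⌊s * n d⌋₊ ⌊t * n d⌋₊) ?_).congr fun z => ?_
  · simpa using tendsto_floor_mul_sub_floor_mul_div hn hs hst
  · exact (norm_walkPoint_sub_sq _ _ (Nat.floor_mono (by gcongr))).symm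

theorem tendsto_inner_walkPoint (hX : IsNegligibleArray P X v l) (hn : Tendsto n l atTop)
    {s t : ℝ} (hs : 0 ≤ s) (ht : 0 ≤ t) :
    Tendsto (fun z : Σ d, Ω d =>
        inner ℝ (walkPoint (n z.1) (fun i => X z.1 i z.2) ⌊s * n z.1⌋₊)
          (walkPoint (n z.1) (fun i => X z.1 i z.2) ⌊t * n z.1⌋₊))
      (highProb P l) (𝓝 (min s t)) := by
  wlog hst : s ≤ t generalizing s t
  · simpa only [real_inner_comm, min_comm] using this ht hs (le_of_not_ge hst)
  have hnorm : ∀ u : ℝ, 0 ≤ u → Tendsto (fun z : Σ d, Ω d =>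
      ‖walkPoint (n z.1) (fun i => X z.1 i z.2) ⌊u * n z.1⌋₊‖ ^ 2) (highProb P l) (𝓝 u) :=
    fun u hu => by
      simpa [walkPoint_zero] using hX.tendsto_norm_walkPoint_sub_sq hn le_rfl hu
  have h := (((hnorm s hs).add (hnorm t ht)).sub
    (hX.tendsto_norm_walkPoint_sub_sq hn hs hst)).div_const 2
  rw [show (s + t - (t - s)) / 2 = min s t by rw [min_eq_left hst]; ring] at h
  refine h.congr fun z => ?_
  rw [norm_sub_rev, real_inner_eq_norm_mul_self_add_norm_mul_self_sub_norm_sub_mul_self_div_two]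
  simp only [sq]

theorem eventually_forall_norm_walkPoint_sub_floor_sq_lt (hX : IsNegligibleArray P X v l)
    (hn : Tendsto n l atTop) {s t c : ℝ} (hs : 0 ≤ s) (hst : s ≤ t) (hc : t - s < c) :
    ∀ᶠ z : Σ d, Ω d in highProb P l, ∀ k, ⌊s * n z.1⌋₊ ≤ k → k ≤ ⌊t * n z.1⌋₊ →
      ‖walkPoint (n z.1) (fun i => X z.1 i z.2) k -
        walkPoint (n z.1) (fun i => X z.1 i z.2) ⌊s * n z.1⌋₊‖ ^ 2 < c := by
  filter_upwards [hX.eventually_forall_norm_sum_Ico_sq_lt hn (fun d => ⌊s * n d⌋₊)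
    (tendsto_floor_mul_sub_floor_mul_div hn hs hst) hc,
    tendsto_fst_highProb.eventually (hn.eventually_ge_atTop 1)] with z hz hnz k hsk hkt
  rw [norm_walkPoint_sub_sq _ _ hsk, div_lt_iff₀ (Nat.cast_pos.2 hnz)]
  simpa only [Nat.add_sub_cancel' hsk] using hz (k - ⌊s * n z.1⌋₊) (by lia)

theorem eventually_hdist_walkSet_spiral_le (hX : IsNegligibleArray P X v l)
    (hn : Tendsto n l atTop) {ε : ℝ} (hε : 0 < ε) :
    ∀ᶠ z : Σ d, Ω d in highProb P l, Shape.hdist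
      (Shape.mk (walkSet (n z.1) fun i => X z.1 i z.2)) (Shape.mk spiral) ≤ ε := by
  have hr : 0 < ε / 2 := half_pos hε
  obtain ⟨N, hN, hNε⟩ := Real.exists_nat_pos_inv_lt (sq_pos_of_pos hr)
  rw [← one_div] at hNε
  have hτ : ∀ i : Fin (N + 1), (i / N : ℝ) ∈ Set.Icc 0 1 := fun i =>
    ⟨by positivity, div_le_one_of_le₀ (Nat.cast_le.2 (Nat.le_of_lt_succ i.2)) (Nat.cast_nonneg _)⟩
  let y : (Σ d, Ω d) → Fin (N + 1) → L2Seq := fun z i =>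
    walkPoint (n z.1) (fun j => X z.1 j z.2) ⌊(i / N : ℝ) * n z.1⌋₊
  let w : Fin (N + 1) → L2Seq := fun i => spiralPoint (i / N)
  have hgram : ∀ i, ∀ᶠ z in highProb P l, dist (gramRoot (y z) i) (gramRoot w i) < ε / 2 :=
    fun i => Metric.tendsto_nhds.1 (tendsto_gramRoot (fun i j => by
      simpa only [w, inner_spiralPoint (hτ i) (hτ j)] using
        hX.tendsto_inner_walkPoint hn (hτ i).1 (hτ j).1) i) _ hr
  have hosc := fun i : Fin (N + 1) =>
    hX.eventually_forall_norm_walkPoint_sub_floor_sq_lt hn (hτ i).1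
      (t := (i + 1) / N) (by gcongr; linarith) (by rwa [← sub_div, add_sub_cancel_left])
  filter_upwards [eventually_all.2 hgram, eventually_all.2 hosc] with z hz hzosc
  rw [← add_halves ε]
  refine Shape.hdist_mk_le_of_net (y := y z) (w := w) (fun i => ⟨_, ?_, rfl⟩) ?_
    (fun i => ⟨_, hτ i, rfl⟩) ?_ fun i => (hz i).le
  · exact Nat.floor_le_of_le (mul_le_of_le_one_left (Nat.cast_nonneg _) (hτ i).2)
  · rintro _ ⟨k, hk, rfl⟩
    obtain ⟨i, hik, hki⟩ := exists_floor_div_mul_le_le hN hk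
    refine ⟨i, le_of_lt (lt_of_pow_lt_pow_left₀ 2 hr.le ?_)⟩
    rw [dist_eq_norm]
    exact hzosc i k hik hki
  · rintro _ ⟨t, ht, rfl⟩
    obtain ⟨i, hi⟩ := exists_dist_spiralPoint_div_sq_le hN ht
    exact ⟨i, le_of_lt (lt_of_pow_lt_pow_left₀ 2 hr.le (hi.trans_lt hNε))⟩

end IsNegligibleArray

/-! ### Identically distributed increments -/

theorem integral_inner_sq_le_of_uncorrelated {Ω ι : Type*} [Fintype ι] [MeasurableSpace Ω]
    {P : Measure Ω} {Z : Ω → EuclideanSpace ℝ ι} {v : ℝ} (hZ : MemLp Z 2 P)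
    (hZ0 : ∀ j k, j ≠ k → ∫ ω, Z ω j * Z ω k ∂P = 0) (hv : ∀ k, ∫ ω, Z ω k ^ 2 ∂P ≤ v)
    (u : EuclideanSpace ℝ ι) : ∫ ω, inner ℝ u (Z ω) ^ 2 ∂P ≤ v * ‖u‖ ^ 2 := by
  have hcoord : ∀ k, MemLp (fun ω => Z ω k) 2 P := fun k =>
    hZ.continuousLinearMap_comp (EuclideanSpace.proj k : EuclideanSpace ℝ ι →L[ℝ] ℝ)
  have hint : ∀ j k, Integrable (fun ω => u j * u k * (Z ω j * Z ω k)) P := fun j k =>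
    ((hcoord j).integrable_mul (hcoord k)).const_mul _
  calc ∫ ω, inner ℝ u (Z ω) ^ 2 ∂P
      = ∫ ω, ∑ j, ∑ k, u j * u k * (Z ω j * Z ω k) ∂P := by
        refine integral_congr_ae (.of_forall fun ω => ?_)
        simp only [PiLp.inner_apply, RCLike.inner_apply, conj_trivial, sq, Finset.sum_mul_sum]
        exact Finset.sum_congr rfl fun j _ => Finset.sum_congr rfl fun k _ => by ring
    _ = ∑ j, ∑ k, u j * u k * ∫ ω, Z ω j * Z ω k ∂P := by
        rw [integral_finsetSum _ fun j _ => integrable_finsetSum _ fun k _ => hint j k]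
        refine Finset.sum_congr rfl fun j _ => ?_
        rw [integral_finsetSum _ fun k _ => hint j k]
        simp only [integral_const_mul]
    _ = ∑ k, (∫ ω, Z ω k ^ 2 ∂P) * u k ^ 2 := by
        refine Finset.sum_congr rfl fun j _ => ?_
        rw [Finset.sum_eq_single j (fun k _ hk => by rw [hZ0 j k hk.symm, mul_zero]) (by simp)]
        simp only [sq, mul_comm]
    _ ≤ v * ‖u‖ ^ 2 := by
        rw [EuclideanSpace.real_norm_sq_eq, Finset.mul_sum]
        gcongr with k
        exact hv k

theorem integral_abs_sub_truncation_le {Ω : Type*} [MeasurableSpace Ω] {P : Measure Ω}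
    {f : Ω → ℝ} (hf : Measurable f) (hf0 : ∀ ω, 0 ≤ f ω) {A η : ℝ} (hη : 0 ≤ η)
    (h : ∫⁻ ω in {ω | A < f ω}, ENNReal.ofReal (f ω) ∂P ≤ ENNReal.ofReal η) :
    ∫ ω, |f ω - truncation f A ω| ∂P ≤ η := by
  have habs : (fun ω => |f ω - truncation f A ω|) = {ω | A < f ω}.indicator f := by
    funext ω
    rw [truncation_eq_of_nonneg hf0, Function.comp_apply]
    rcases lt_or_ge A (f ω) with hω | hω
    · simp [hω, hω.not_ge, abs_of_nonneg (hf0 ω)]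
    · rcases (hf0 ω).eq_or_lt' with h0 | h0 <;>
        simp [Set.indicator, hω.not_gt, hω, h0]
  have hset : MeasurableSet {ω | A < f ω} := measurableSet_lt measurable_const hf
  rw [habs, integral_indicator hset, integral_eq_lintegral_of_nonneg_ae (.of_forall hf0)
    hf.aestronglyMeasurable]
  exact ENNReal.toReal_le_of_le_ofReal hη h

theorem IsNormalizedIncrements.of_identDistrib {Ω ι E : Type*} [MeasurableSpace Ω]
    {P : Measure Ω} [NormedAddCommGroup E] [InnerProductSpace ℝ E] [MeasurableSpace E]
    [BorelSpace E] {X : ι → Ω → E} {v : ℝ} {i₀ : ι} (hmeas : ∀ i, Measurable (X i))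
    (hindep : iIndepFun X P) (hident : ∀ i, IdentDistrib (X i) (X i₀) P P)
    (hmean : ∫ ω, X i₀ ω ∂P = 0) (hnorm : ∫ ω, ‖X i₀ ω‖ ^ 2 ∂P = 1)
    (hcov : ∀ u, ∫ ω, inner ℝ u (X i₀ ω) ^ 2 ∂P ≤ v * ‖u‖ ^ 2) :
    IsNormalizedIncrements P X v where
  measurable := hmeas
  indep := hindep
  integral_eq_zero i := (hident i).integral_eq.trans hmean
  integral_norm_sq i :=
    ((hident i).comp (u := fun z => ‖z‖ ^ 2) (by fun_prop)).integral_eq.trans hnorm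
  integral_inner_sq_le i u :=
    ((hident i).comp (u := fun z => inner ℝ u z ^ 2)
      (by fun_prop)).integral_eq.trans_le (hcov u)

theorem isNegligibleArray_of_identDistrib {Ω : ℕ → Type*} [∀ d, MeasurableSpace (Ω d)]
    {P : ∀ d, Measure (Ω d)} {X : ∀ d, ℕ → Ω d → EuclideanSpace ℝ (Fin d)}
    (hmeas : ∀ d, 1 ≤ d → ∀ i, Measurable (X d i))
    (hindep : ∀ d, 1 ≤ d → iIndepFun (X d) (P d))
    (hident : ∀ d, 1 ≤ d → ∀ i, IdentDistrib (X d i) (X d 0) (P d) (P d))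
    (hmean : ∀ d, 1 ≤ d → ∫ ω, X d 0 ω ∂(P d) = 0)
    (hnorm : ∀ d, 1 ≤ d → ∫ ω, ‖X d 0 ω‖ ^ 2 ∂(P d) = 1)
    (huncor : ∀ d, 1 ≤ d → ∀ j k : Fin d, j ≠ k → ∫ ω, X d 0 ω j * X d 0 ω k ∂(P d) = 0)
    (hui : Tendsto (fun A : ℝ => ⨆ d : ℕ, ⨆ _ : 1 ≤ d,
      ∫⁻ ω in {ω | A < ‖X d 0 ω‖ ^ 2}, ENNReal.ofReal (‖X d 0 ω‖ ^ 2) ∂(P d)) atTop (𝓝 0))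
    (hnegl : Tendsto (fun d : ℕ => ⨆ k : Fin d, ∫ ω, (X d 0 ω k) ^ 2 ∂(P d)) atTop (𝓝 0)) :
    IsNegligibleArray P X (fun d => ⨆ k : Fin d, ∫ ω, (X d 0 ω k) ^ 2 ∂(P d)) atTop where
  increments := by
    filter_upwards [eventually_ge_atTop 1] with d hd
    refine .of_identDistrib (hmeas d hd) (hindep d hd) (hident d hd) (hmean d hd) (hnorm d hd)
      (integral_inner_sq_le_of_uncorrelated ?_ (huncor d hd)
        fun k => le_ciSup (f := fun k => ∫ ω, X d 0 ω k ^ 2 ∂(P d))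
          (Set.finite_range _).bddAbove k)
    exact memLp_two_of_integral_norm_sq_ne_zero (hmeas d hd 0).aestronglyMeasurable
      (hnorm d hd ▸ one_ne_zero)
  tendsto_zero := hnegl
  exists_truncation η hη := by
    obtain ⟨A, hA, hA0⟩ := ((hui.eventually_le_const
      (ENNReal.ofReal_pos.2 hη)).and (eventually_ge_atTop 0)).exists
    refine ⟨A, hA0, ?_⟩
    filter_upwards [eventually_ge_atTop 1] with d hd i
    have htail : ∫ ω, |‖X d i ω‖ ^ 2 - truncation (fun ω => ‖X d i ω‖ ^ 2) A ω| ∂(P d) =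
        ∫ ω, |‖X d 0 ω‖ ^ 2 - truncation (fun ω => ‖X d 0 ω‖ ^ 2) A ω| ∂(P d) :=
      ((hident d hd i).comp (u := fun z => |‖z‖ ^ 2 - truncation (fun z => ‖z‖ ^ 2) A z|)
        (by unfold truncation; fun_prop (disch := measurability))).integral_eq
    rw [htail]
    exact integral_abs_sub_truncation_le ((hmeas d hd 0).norm.pow_const 2)
      (fun ω => sq_nonneg _) hη.le ((le_iSup₂ (f := fun (d : ℕ) (_ : 1 ≤ d) =>
        ∫⁻ ω in {ω | A < ‖X d 0 ω‖ ^ 2}, ENNReal.ofReal (‖X d 0 ω‖ ^ 2) ∂(P d)) d hd).trans hA)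

end WienerSpiral

end

theorem mainTheorem6
    {Ω : ℕ → Type*} [∀ d, MeasurableSpace (Ω d)]
    (P : ∀ d, Measure (Ω d)) [∀ d, IsProbabilityMeasure (P d)]
    (X : ∀ d, ℕ → Ω d → EuclideanSpace ℝ (Fin d))
    (n : ℕ → ℕ) (hn_pos : ∀ d, 1 ≤ d → 1 ≤ n d) (hn : Tendsto n atTop atTop)
    -- the increments are independent and identically distributed random vectors
    (hX_meas : ∀ d, 1 ≤ d → ∀ i, Measurable (X d i))
    (hX_indep : ∀ d, 1 ≤ d → iIndepFun (X d) (P d))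
    (hX_ident : ∀ d, 1 ≤ d → ∀ i, IdentDistrib (X d i) (X d 0) (P d) (P d))
    -- (a) centered and normalized
    (hX_mean : ∀ d, 1 ≤ d → ∫ ω, X d 0 ω ∂(P d) = 0)
    (hX_norm : ∀ d, 1 ≤ d → ∫ ω, ‖X d 0 ω‖ ^ 2 ∂(P d) = 1)
    -- (b) uncorrelated components
    (hX_uncor : ∀ d, 1 ≤ d → ∀ j k : Fin d, j ≠ k → ∫ ω, X d 0 ω j * X d 0 ω k ∂(P d) = 0)
    -- (c) uniform integrability of the squared norms
    (hX_ui : Tendsto (fun A : ℝ => ⨆ d : ℕ, ⨆ _ : 1 ≤ d,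
        ∫⁻ ω in {ω | A < ‖X d 0 ω‖ ^ 2}, ENNReal.ofReal (‖X d 0 ω‖ ^ 2) ∂(P d)) atTop (𝓝 0))
    -- (d) negligibility of the components
    (hX_negl : Tendsto (fun d : ℕ => ⨆ k : Fin d, ∫ ω, (X d 0 ω k) ^ 2 ∂(P d)) atTop (𝓝 0)) :
    -- convergence in probability of the convex hulls
    (∀ ε : ℝ, 0 < ε → Tendsto (fun d : ℕ => P d {ω | ε <
        WienerSpiral.Shape.hdist
          (WienerSpiral.Shape.mk (WienerSpiral.walkHull (n d) (fun i => X d i ω)))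
          (WienerSpiral.Shape.mk (WienerSpiral.cch WienerSpiral.spiral))}) atTop (𝓝 0)) ∧
    -- the closed convex hull map is well defined and 1-Lipschitz on isometry classes
    (∃ CCH : WienerSpiral.Shape → WienerSpiral.Shape,
      (∀ K, CCH (WienerSpiral.Shape.mk K) = WienerSpiral.Shape.mk (WienerSpiral.cch K)) ∧
      ∀ x y, WienerSpiral.Shape.hdist (CCH x) (CCH y) ≤ WienerSpiral.Shape.hdist x y) := by
  refine ⟨fun ε hε => ?_, WienerSpiral.Shape.cch, WienerSpiral.Shape.cch_mk,
    WienerSpiral.Shape.hdist_cch_le⟩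
  have hX := WienerSpiral.isNegligibleArray_of_identDistrib hX_meas hX_indep hX_ident hX_mean
    hX_norm hX_uncor hX_ui hX_negl
  have hhull : ∀ᶠ z in WienerSpiral.highProb P atTop, WienerSpiral.Shape.hdist
      (WienerSpiral.Shape.mk (WienerSpiral.walkHull (n z.1) fun i => X z.1 i z.2))
      (WienerSpiral.Shape.mk (WienerSpiral.cch WienerSpiral.spiral)) ≤ ε := by
    filter_upwards [hX.eventually_hdist_walkSet_spiral_le hn hε] with z hz
    rw [← WienerSpiral.cch_walkSet, ← WienerSpiral.Shape.cch_mk, ← WienerSpiral.Shape.cch_mk]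
    exact (WienerSpiral.Shape.hdist_cch_le _ _).trans hz
  simpa only [WienerSpiral.eventually_highProb, not_le] using hhull
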